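/- Let $d\ge 1$ and let $\mathcal B$, $\mathcal B_0$ denote the linear operators and the traceless linear operators on $\mathbb C^d$. For a finite set $A\subset\mathbb Z$ put $\mathcal B_0^A=\mathcal B_0^{\otimes A}$ (with $\mathcal B_0^\emptyset=\mathbb C$). A formal operator on the infinite chain is a family $\Phi=\sum_A\Phi(A)$ with $\Phi(A)\in\mathcal B_0^A$ for every finite $A\subset\mathbb Z$. It is at most $n$-local if $\Phi(A)=0$ whenever $A\ne\emptyset$ and $\max A-\min A+1>n$, local if it is at most $n$-local for some $n$, Hermitian if every $\Phi(A)$ is, and translation invariant if $\Phi(A+x)$ is the translate of $\Phi(A)$ by $x$ for all $A$ and all $x\in\mathbb Z$. For finite $B\subset\mathbb Z$ let $\Phi|_B=\sum_{A\subseteq B}\Phi(A)\otimes I_{B\setminus A}\in\mathcal B^{\otimes B}$, and for $Y\in\mathcal B^{\otimes B}=\bigoplus_{A\subseteq B}\mathcal B_0^A$ let $Y_A$ be its component in $\mathcal B_0^A$. For $\Phi$ local and $\Psi$ arbitrary, the commutator is the formal operator $[\Phi,\Psi](A)=\big[\Phi|_B,\Psi|_B\big]_A$, where $B\supseteq A$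 is any sufficiently large finite set (the value does not depend on its choice). Let $H=\sum_{j\in\mathbb Z}(h^{(2)}_j+h^{(1)}_j)$ with $h^{(2)}_j\in\mathcal B_0^{\{j,j+1\}}$ and $h^{(1)}_j\in\mathcal B_0^{\{j\}}$ be Hermitian and translation invariant, let $C$ be any translation-invariant formal operator that is at most $1$-local, and let $$B_H=\sum_{j\in\mathbb Z}j\,\big(h^{(2)}_j+h^{(1)}_j\big)+C .$$ Define $Q^{(2)}=H$ and $Q^{(n+1)}=[B_H,Q^{(n)}]$ for $n\ge 2$. If $[H,Q^{(3)}]=0$, then for every $n\ge 2$ the operator $Q^{(n)}$ is at most $n$-local, is translation invariant and satisfies $[H,Q^{(n)}]=0$; moreover $[Q^{(m)},Q^{(n)}]=0$ for all $m,n\ge 2$. -/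

import Mathlib

namespace SpinChain

/-- Linear operators on the tensor product of one copy of `ℂ^d` for each site of `A`, as matrices
in the product basis, which is labelled by the configurations `A → Fin d`. -/
abbrev Op (d : ℕ) (A : Finset ℤ) : Type := Matrix (A → Fin d) (A → Fin d) ℂ

/-- The tensor product of one-site operators, one for each site of `A`. -/
def prodOp {d : ℕ} {A : Finset ℤ} (X : A → Matrix (Fin d) (Fin d) ℂ) : Op d A :=
  Matrix.of fun σ σ' => ∏ a, X a (σ a) (σ' a)

/-- The tensor product over the sites of `A` of the spaces of traceless one-site operators. For
`A = ∅` it consists of the scalars. -/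
def tracelessOps (d : ℕ) (A : Finset ℤ) : Submodule ℂ (Op d A) :=
  Submodule.span ℂ {Y | ∃ X : A → Matrix (Fin d) (Fin d) ℂ, (∀ a, (X a).trace = 0) ∧ Y = prodOp X}

/-- A formal operator `Φ = ∑_A Φ(A)` on the infinite chain: a family indexed by the finite sets `A`
of sites, where `Φ(A)` is a tensor product of traceless operators on the sites of `A`. -/
abbrev FormalOp (d : ℕ) : Type := (A : Finset ℤ) → tracelessOps d A

/-- `X ↦ X ⊗ 1`, where the identity acts on the sites of `B` outside `A`. -/
def embed {d : ℕ} {A B : Finset ℤ} (h : A ⊆ B) (X : Op d A) : Op d B :=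
  Matrix.of fun σ σ' =>
    if ∀ b : B, b.1 ∉ A → σ b = σ' b then
      X (fun a => σ ⟨a.1, h a.2⟩) (fun a => σ' ⟨a.1, h a.2⟩)
    else 0

/-- The restriction `Φ|_B = ∑_{A ⊆ B} Φ(A)`. -/
def restrict {d : ℕ} (Φ : FormalOp d) (B : Finset ℤ) : Op d B :=
  ∑ A : {A : Finset ℤ // A ∈ B.powerset}, embed (Finset.mem_powerset.1 A.2) (Φ A.1 : Op d A.1)

/-- The traceless part of a one-site operator. -/
noncomputable def tracelessPart {d : ℕ} (X : Matrix (Fin d) (Fin d) ℂ) :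
    Matrix (Fin d) (Fin d) ℂ :=
  X - (X.trace / d) • (1 : Matrix (Fin d) (Fin d) ℂ)

theorem trace_tracelessPart {d : ℕ} [NeZero d] (X : Matrix (Fin d) (Fin d) ℂ) :
    (tracelessPart X).trace = 0 := by
  have hd : (d : ℂ) ≠ 0 := Nat.cast_ne_zero.2 (NeZero.ne d)
  simp [tracelessPart, Matrix.trace_sub, Matrix.trace_smul, hd]

/-- The component `Y_A` of `Y` in the decomposition of the operators on `B` as the direct sum, over
`A ⊆ B`, of `tracelessOps d A`. It is the linear map that sends a product operator `⊗_{b ∈ B} X_b`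
to `∏_{b ∈ B ∖ A} (tr X_b / d) · ⊗_{a ∈ A} (X_a - (tr X_a / d) 1)`, written out here through the
expansion of `Y` in tensor products of matrix units. -/
noncomputable def component {d : ℕ} [NeZero d] {A B : Finset ℤ} (h : A ⊆ B) (Y : Op d B) :
    tracelessOps d A :=
  ∑ σ : B → Fin d, ∑ σ' : B → Fin d,
    (Y σ σ' * ∏ b : B, if b.1 ∈ A then 1 else
        (Matrix.single (σ b) (σ' b) (1 : ℂ)).trace / d) •
      (⟨prodOp fun a : A => tracelessPart
          (Matrix.single (σ ⟨a.1, h a.2⟩) (σ' ⟨a.1, h a.2⟩) (1 : ℂ)),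
        Submodule.subset_span ⟨_, fun _ => trace_tracelessPart _, rfl⟩⟩ : tracelessOps d A)

/-- `Z` is the value of `[Φ|_B, Ψ|_B]_A` for every sufficiently large finite set `B` of sites. -/
def IsCommAt {d : ℕ} [NeZero d] (Φ Ψ : FormalOp d) (A : Finset ℤ) (Z : tracelessOps d A) : Prop :=
  ∃ B₀ : Finset ℤ, ∀ B : Finset ℤ, B₀ ⊆ B → ∀ h : A ⊆ B,
    component h (restrict Φ B * restrict Ψ B - restrict Ψ B * restrict Φ B) = Z

open Classical in
/-- The commutator `[Φ, Ψ]`, whose value at `A` is `[Φ|_B, Ψ|_B]_A` for any sufficiently large `B`.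
Such a stable value exists and is unique when `Φ` is local: see `isCommAt_comm` below. -/
noncomputable def comm {d : ℕ} [NeZero d] (Φ Ψ : FormalOp d) : FormalOp d := fun A =>
  if h : ∃ Z, IsCommAt Φ Ψ A Z then h.choose else 0

/-- The range `max A - min A + 1` of a finite set of sites; it is `0` for the empty set. -/
def setRange (A : Finset ℤ) : ℕ :=
  if h : A.Nonempty then (A.max' h - A.min' h + 1).toNat else 0

/-- `Φ` is a sum of terms that act on at most `n` contiguous sites. -/
def AtMostLocal {d : ℕ} (n : ℕ) (Φ : FormalOp d) : Prop :=
  ∀ A, Φ A ≠ 0 → setRange A ≤ n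

section WellDefined

variable {d : ℕ}

theorem prodOp_mul {A : Finset ℤ} (X Y : A → Matrix (Fin d) (Fin d) ℂ) :
    prodOp X * prodOp Y = prodOp fun a => X a * Y a := by
  ext σ σ'
  simp only [prodOp, Matrix.mul_apply, Matrix.of_apply, Finset.prod_univ_sum,
    Fintype.piFinset_univ, ← Finset.prod_mul_distrib]

theorem embed_prodOp {A B : Finset ℤ} (h : A ⊆ B) (X : A → Matrix (Fin d) (Fin d) ℂ) :
    embed h (prodOp X) = prodOp fun b : B => if hb : b.1 ∈ A then X ⟨b.1, hb⟩ else 1 := by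
  ext σ σ'
  simp only [embed, prodOp, Matrix.of_apply]
  have e : (∏ b : B, (if hb : b.1 ∈ A then X ⟨b.1, hb⟩ else 1) (σ b) (σ' b)) =
      (∏ a : A, X a (σ ⟨a.1, h a.2⟩) (σ' ⟨a.1, h a.2⟩)) *
        ∏ b : B, (if b.1 ∈ A then 1 else (1 : Matrix (Fin d) (Fin d) ℂ) (σ b) (σ' b)) := by
    have : (∏ a : A, X a (σ ⟨a.1, h a.2⟩) (σ' ⟨a.1, h a.2⟩)) =
        ∏ b : B, (if hb : b.1 ∈ A then X ⟨b.1, hb⟩ (σ b) (σ' b) else 1) := by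
      refine Finset.prod_of_injOn (fun a : A => (⟨a.1, h a.2⟩ : B)) ?_ ?_ ?_ ?_
      · intro a _ b _ hab; exact Subtype.ext (congrArg (fun b : B => b.1) hab)
      · intro a _; simp
      · intro b _ hb
        rw [dif_neg]
        intro hbA
        exact hb ⟨⟨b.1, hbA⟩, by simp, rfl⟩
      · intro a _; simp
    rw [this, ← Finset.prod_mul_distrib]
    refine Finset.prod_congr rfl fun b _ => ?_
    split_ifs <;> simp
  rw [e]
  split_ifs with hc
  · rw [Finset.prod_eq_one (s := Finset.univ) (f := fun b : B => if b.1 ∈ A then (1 : ℂ) else _),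
      mul_one]
    intro b _
    split_ifs with hb
    · rfl
    · rw [hc b hb, Matrix.one_apply_eq]
  · push Not at hc
    obtain ⟨b, hb, hne⟩ := hc
    rw [Finset.prod_eq_zero (i := b) (Finset.mem_univ _), mul_zero]
    rw [if_neg hb, Matrix.one_apply_ne hne]

theorem embed_add {A B : Finset ℤ} (h : A ⊆ B) (X Y : Op d A) :
    embed h (X + Y) = embed h X + embed h Y := by
  ext σ σ'
  simp only [embed, Matrix.of_apply, Matrix.add_apply]
  split_ifs <;> simp

theorem embed_smul {A B : Finset ℤ} (h : A ⊆ B) (c : ℂ) (X : Op d A) :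
    embed h (c • X) = c • embed h X := by
  ext σ σ'
  simp only [embed, Matrix.of_apply, Matrix.smul_apply]
  split_ifs <;> simp

theorem embed_zero {A B : Finset ℤ} (h : A ⊆ B) : embed h (0 : Op d A) = 0 := by
  simpa using embed_smul h 0 (0 : Op d A)

theorem sum_tracelessPart (X : Matrix (Fin d) (Fin d) ℂ) :
    ∑ i, ∑ j, X i j • tracelessPart (Matrix.single i j (1 : ℂ)) = tracelessPart X := by
  have hX : ∑ i, ∑ j, X i j • Matrix.single i j (1 : ℂ) = X := by
    conv_rhs => rw [Matrix.matrix_eq_sum_single X]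
    simp [Matrix.smul_single]
  have ht : ∑ i, ∑ j, X i j * (Matrix.single i j (1 : ℂ)).trace = X.trace := by
    conv_rhs => rw [← hX]
    simp only [Matrix.trace_sum, Matrix.trace_smul, smul_eq_mul]
  simp only [tracelessPart, smul_sub, Finset.sum_sub_distrib, hX, smul_smul, ← Finset.sum_smul]
  rw [← ht]
  simp only [Finset.sum_div, mul_div_assoc]

theorem sum_trace (X : Matrix (Fin d) (Fin d) ℂ) :
    ∑ i, ∑ j, X i j * ((Matrix.single i j (1 : ℂ)).trace / d) = X.trace / d := by
  have hX : ∑ i, ∑ j, X i j • Matrix.single i j (1 : ℂ) = X := by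
    conv_rhs => rw [Matrix.matrix_eq_sum_single X]
    simp [Matrix.smul_single]
  conv_rhs => rw [← hX]
  simp only [Matrix.trace_sum, Matrix.trace_smul, Finset.sum_div, smul_eq_mul, mul_div_assoc]

theorem span_prodOp (A : Finset ℤ) : Submodule.span ℂ (Set.range (prodOp (d := d) (A := A))) =
    ⊤ := by
  rw [eq_top_iff]
  intro Y _
  rw [Matrix.matrix_eq_sum_single Y]
  refine Submodule.sum_mem _ fun σ _ => Submodule.sum_mem _ fun σ' _ => ?_
  have : Matrix.single σ σ' (Y σ σ') =
      Y σ σ' • prodOp fun a => Matrix.single (σ a) (σ' a) (1 : ℂ) := by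
    ext s s'
    simp only [prodOp, Matrix.single_apply, Matrix.smul_apply, Matrix.of_apply, smul_eq_mul,
      Finset.prod_ite_zero, Finset.prod_const_one, mul_ite, mul_one, mul_zero, funext_iff,
      Finset.mem_univ, true_imp_iff, forall_and]
  rw [this]
  exact Submodule.smul_mem _ _ (Submodule.subset_span ⟨_, rfl⟩)

variable [NeZero d]

theorem component_add {A B : Finset ℤ} (h : A ⊆ B) (Y Z : Op d B) :
    component h (Y + Z) = component h Y + component h Z := by
  simp only [component, Matrix.add_apply, add_mul, add_smul, Finset.sum_add_distrib]

theorem component_smul {A B : Finset ℤ} (h : A ⊆ B) (c : ℂ) (Y : Op d B) :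
    component h (c • Y) = c • component h Y := by
  simp only [component, Matrix.smul_apply, smul_eq_mul, mul_assoc, Finset.smul_sum, mul_smul]

/-- `component` on product operators. -/
theorem component_prodOp {A B : Finset ℤ} (h : A ⊆ B) (X : B → Matrix (Fin d) (Fin d) ℂ) :
    (component h (prodOp X) : Op d A) = (∏ b : B, if b.1 ∈ A then 1 else (X b).trace / d) •
      prodOp fun a : A => tracelessPart (X ⟨a.1, h a.2⟩) := by
  ext s s'
  have split : ∀ f : B → ℂ, ∀ g : A → ℂ,
      (∏ b : B, if b.1 ∈ A then 1 else f b) * ∏ a : A, g a =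
        ∏ b : B, if hb : b.1 ∈ A then g ⟨b.1, hb⟩ else f b := by
    intro f g
    have : (∏ a : A, g a) = ∏ b : B, (if hb : b.1 ∈ A then g ⟨b.1, hb⟩ else 1) := by
      refine Finset.prod_of_injOn (fun a : A => (⟨a.1, h a.2⟩ : B)) ?_ ?_ ?_ ?_
      · intro a _ b _ hab; exact Subtype.ext (congrArg (fun b : B => b.1) hab)
      · intro a _; simp
      · intro b _ hb
        rw [dif_neg]
        intro hbA
        exact hb ⟨⟨b.1, hbA⟩, by simp, rfl⟩
      · intro a _; simp
    rw [this, ← Finset.prod_mul_distrib]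
    refine Finset.prod_congr rfl fun b _ => ?_
    split_ifs <;> simp
  simp only [component, prodOp, Submodule.coe_sum, Submodule.coe_smul, Matrix.sum_apply,
    Matrix.smul_apply, Matrix.of_apply, smul_eq_mul, mul_assoc]
  simp only [split, ← Finset.prod_mul_distrib]
  rw [← Finset.sum_product' (f := fun σ σ' : B → Fin d => ∏ b : B, X b (σ b) (σ' b) *
    if hb : b.1 ∈ A then tracelessPart (Matrix.single (σ b) (σ' b) (1 : ℂ)) (s ⟨b.1, hb⟩)
      (s' ⟨b.1, hb⟩) else (Matrix.single (σ b) (σ' b) (1 : ℂ)).trace / d)]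
  rw [Finset.univ_product_univ, ← (Equiv.arrowProdEquivProdArrow B (fun _ => Fin d)
    (fun _ => Fin d)).sum_comp]
  simp only [Equiv.arrowProdEquivProdArrow, Equiv.coe_fn_mk]
  rw [← Fintype.prod_sum (fun (b : B) (p : Fin d × Fin d) => X b p.1 p.2 *
    if hb : b.1 ∈ A then tracelessPart (Matrix.single p.1 p.2 (1 : ℂ)) (s ⟨b.1, hb⟩)
      (s' ⟨b.1, hb⟩) else (Matrix.single p.1 p.2 (1 : ℂ)).trace / d)]
  refine Finset.prod_congr rfl fun b _ => ?_
  rw [Fintype.sum_prod_type]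
  split_ifs with hb
  · rw [← sum_tracelessPart (X b)]
    simp only [Matrix.sum_apply, Matrix.smul_apply, smul_eq_mul]
  · exact sum_trace (X b)

/-- `component` inverts the embedding on traceless operators. -/
theorem component_embed_self {A B : Finset ℤ} (h : A ⊆ B) (X : tracelessOps d A) :
    component h (embed h (X : Op d A)) = X := by
  have hd : (d : ℂ) ≠ 0 := Nat.cast_ne_zero.2 (NeZero.ne d)
  obtain ⟨X, hX⟩ := X
  refine Subtype.ext ?_
  change (component h (embed h X) : Op d A) = X
  induction hX using Submodule.span_induction with
  | mem Y hY =>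
    obtain ⟨X, hX, rfl⟩ := hY
    rw [embed_prodOp, component_prodOp]
    have e : ∀ a, tracelessPart (X a) = X a := fun a => by simp [tracelessPart, hX]
    rw [Finset.prod_eq_one, one_smul]
    · congr 1; ext1 a; simp [e]
    · intro b _
      split_ifs with hb <;> simp [hd]
  | zero => rw [embed_zero]; simpa using congrArg Subtype.val (component_smul h 0 (0 : Op d B))
  | add X Y _ _ hX hY => rw [embed_add, component_add, Submodule.coe_add, hX, hY]
  | smul c X _ hX => rw [embed_smul, component_smul, Submodule.coe_smul, hX]

theorem component_sum {A B : Finset ℤ} (h : A ⊆ B) {ι : Type*} (s : Finset ι) (Y : ι → Op d B) :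
    component h (∑ i ∈ s, Y i) = ∑ i ∈ s, component h (Y i) :=
  map_sum (AddMonoidHom.mk' (component h) (component_add h)) Y s

/-- The components of commutators of embedded traceless operators vanish unless the supports
overlap suitably. -/
theorem component_commutator {A B C C' : Finset ℤ} (h : A ⊆ B) (hC : C ⊆ B) (hC' : C' ⊆ B)
    (X : tracelessOps d C) (Y : tracelessOps d C') (hn : Disjoint C A ∨ ¬ C' ⊆ A ∪ C) :
    component h (embed hC (X : Op d C) * embed hC' (Y : Op d C')) =
      component h (embed hC' (Y : Op d C') * embed hC (X : Op d C)) := by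
  obtain ⟨X, hX⟩ := X
  obtain ⟨Y, hY⟩ := Y
  change component h (embed hC X * embed hC' Y) = component h (embed hC' Y * embed hC X)
  induction hX, hY using Submodule.span_induction₂ with
  | mem_mem X Y hX hY =>
    obtain ⟨X, hX, rfl⟩ := hX
    obtain ⟨Y, hY, rfl⟩ := hY
    refine Subtype.ext ?_
    simp only [embed_prodOp, prodOp_mul, component_prodOp]
    rcases hn with hn | hn
    · congr 1
      · refine Finset.prod_congr rfl fun b _ => ?_
        rw [Matrix.trace_mul_comm]
      · congr 1; ext1 a
        have : a.1 ∉ C := fun hc => Finset.disjoint_left.1 hn hc a.2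
        simp [this]
    · obtain ⟨b, hb, hbn⟩ := Finset.not_subset.1 hn
      simp only [Finset.mem_union, not_or] at hbn
      rw [Finset.prod_eq_zero (i := ⟨b, hC' hb⟩) (Finset.mem_univ _), zero_smul,
        Finset.prod_eq_zero (i := ⟨b, hC' hb⟩) (Finset.mem_univ _), zero_smul]
      all_goals simp [hbn, hb, hY]
  | zero_left => simp [embed_zero]
  | zero_right => simp [embed_zero]
  | add_left X X' Y _ _ _ h₁ h₂ => simp only [embed_add, add_mul, mul_add, component_add, h₁, h₂]
  | add_right X Y Y' _ _ _ h₁ h₂ => simp only [embed_add, add_mul, mul_add, component_add, h₁, h₂]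
  | smul_left c X Y _ _ h₁ =>
    simp only [embed_smul, smul_mul_assoc, mul_smul_comm, component_smul, h₁]
  | smul_right c X Y _ _ h₁ =>
    simp only [embed_smul, smul_mul_assoc, mul_smul_comm, component_smul, h₁]

/-- The components of products do not depend on the surrounding region. -/
theorem component_mul_indep {A B B' C C' : Finset ℤ} (h : A ⊆ B) (hB : B ⊆ B') (hC : C ⊆ B)
    (hC' : C' ⊆ B) (X : Op d C) (Y : Op d C') :
    component (h.trans hB) (embed (hC.trans hB) X * embed (hC'.trans hB) Y) =
      component h (embed hC X * embed hC' Y) := by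
  have hd : (d : ℂ) ≠ 0 := Nat.cast_ne_zero.2 (NeZero.ne d)
  have hX : X ∈ Submodule.span ℂ (Set.range (prodOp (d := d) (A := C))) := by
    rw [span_prodOp]; trivial
  have hY : Y ∈ Submodule.span ℂ (Set.range (prodOp (d := d) (A := C'))) := by
    rw [span_prodOp]; trivial
  induction hX, hY using Submodule.span_induction₂ with
  | mem_mem X Y hX hY =>
    obtain ⟨X, rfl⟩ := hX
    obtain ⟨Y, rfl⟩ := hY
    refine Subtype.ext ?_
    simp only [embed_prodOp, prodOp_mul, component_prodOp]
    congr 1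
    symm
    refine Finset.prod_of_injOn (fun b : B => (⟨b.1, hB b.2⟩ : B')) ?_ ?_ ?_ ?_
    · intro a _ b _ hab; exact Subtype.ext (congrArg (fun b : B' => b.1) hab)
    · intro a _; simp
    · intro b _ hb
      have hbB : b.1 ∉ B := fun hbB => hb ⟨⟨b.1, hbB⟩, by simp, rfl⟩
      have h₁ : b.1 ∉ C := fun hc => hbB (hC hc)
      have h₂ : b.1 ∉ C' := fun hc => hbB (hC' hc)
      simp [h₁, h₂, hd]
    · intro a _; simp
  | zero_left =>
    have z : ∀ {B : Finset ℤ} (h : A ⊆ B), component h (0 : Op d B) = 0 := fun h => by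
      simpa using component_smul h 0 (0 : Op d _)
    simp [embed_zero, z]
  | zero_right =>
    have z : ∀ {B : Finset ℤ} (h : A ⊆ B), component h (0 : Op d B) = 0 := fun h => by
      simpa using component_smul h 0 (0 : Op d _)
    simp [embed_zero, z]
  | add_left X X' Y _ _ _ h₁ h₂ => simp only [embed_add, add_mul, component_add, h₁, h₂]
  | add_right X Y Y' _ _ _ h₁ h₂ => simp only [embed_add, mul_add, component_add, h₁, h₂]
  | smul_left c X Y _ _ h₁ =>
    simp only [embed_smul, smul_mul_assoc, component_smul, h₁]
  | smul_right c X Y _ _ h₁ =>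
    simp only [embed_smul, mul_smul_comm, component_smul, h₁]

theorem component_sub {A B : Finset ℤ} (h : A ⊆ B) (Y Z : Op d B) :
    component h (Y - Z) = component h Y - component h Z :=
  map_sub (AddMonoidHom.mk' (component h) (component_add h)) Y Z

theorem component_restrict {A B : Finset ℤ} (h : A ⊆ B) (Φ Ψ : FormalOp d) :
    component h (restrict Φ B * restrict Ψ B - restrict Ψ B * restrict Φ B) =
      ∑ p ∈ B.powerset ×ˢ B.powerset, if hp : p.1 ⊆ B ∧ p.2 ⊆ B then
        component h (embed hp.1 (Φ p.1 : Op d p.1) * embed hp.2 (Ψ p.2 : Op d p.2)) -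
        component h (embed hp.2 (Ψ p.2 : Op d p.2) * embed hp.1 (Φ p.1 : Op d p.1)) else 0 := by
  simp only [restrict]
  rw [Finset.sum_mul_sum, Finset.sum_mul_sum, Finset.sum_comm (γ := {A // A ∈ B.powerset}),
    ← Finset.sum_sub_distrib, Finset.sum_product_right, component_sum, ← Finset.sum_coe_sort B.powerset]
  refine Finset.sum_congr rfl fun C' _ => ?_
  rw [← Finset.sum_sub_distrib, component_sum, ← Finset.sum_coe_sort B.powerset]
  refine Finset.sum_congr rfl fun C _ => ?_
  rw [dif_pos ⟨Finset.mem_powerset.1 C.2, Finset.mem_powerset.1 C'.2⟩, component_sub]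

theorem exists_isCommAt {n : ℕ} {Φ : FormalOp d} (hΦ : AtMostLocal n Φ) (Ψ : FormalOp d)
    (A : Finset ℤ) : ∃ Z, IsCommAt Φ Ψ A Z := by
  set U : Finset ℤ := A ∪ A.biUnion fun a => Finset.Icc (a - n) (a + n) with hU
  have hAU : A ⊆ U := Finset.subset_union_left
  refine ⟨component hAU (restrict Φ U * restrict Ψ U - restrict Ψ U * restrict Φ U), U,
    fun B hB h => ?_⟩
  rw [component_restrict, component_restrict]
  symm
  refine Finset.sum_subset_zero_on_sdiff
    (Finset.product_subset_product (Finset.powerset_mono.2 hB) (Finset.powerset_mono.2 hB)) ?_ ?_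
  · intro p hp
    split_ifs with hpB
    · rw [sub_eq_zero]
      by_cases hz : Φ p.1 = 0
      · simp [hz, embed_zero]
      have hr := hΦ _ hz
      refine component_commutator h hpB.1 hpB.2 (Φ p.1) (Ψ p.2) ?_
      by_contra! hcon
      obtain ⟨hd, hsub⟩ := hcon
      obtain ⟨a, haC, haA⟩ := Finset.not_disjoint_iff.1 hd
      have hCU : p.1 ⊆ U := by
        intro c hc
        rw [setRange, dif_pos ⟨a, haC⟩] at hr
        have h1 := Finset.le_max' _ a haC
        have h2 := Finset.min'_le _ a haC
        have h3 := Finset.le_max' _ c hc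
        have h4 := Finset.min'_le _ c hc
        refine Finset.mem_union_right _ (Finset.mem_biUnion.2 ⟨a, haA, Finset.mem_Icc.2 ?_⟩)
        omega
      refine (Finset.mem_sdiff.1 hp).2 (Finset.mem_product.2
        ⟨Finset.mem_powerset.2 hCU, Finset.mem_powerset.2 (hsub.trans ?_)⟩)
      exact Finset.union_subset hAU hCU
    · rfl
  · intro p hp
    obtain ⟨h1, h2⟩ := Finset.mem_product.1 hp
    have h1 := Finset.mem_powerset.1 h1
    have h2 := Finset.mem_powerset.1 h2
    rw [dif_pos ⟨h1, h2⟩, dif_pos ⟨h1.trans hB, h2.trans hB⟩,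
      component_mul_indep hAU hB h1 h2, component_mul_indep hAU hB h2 h1]

theorem IsCommAt.unique {Φ Ψ : FormalOp d} {A : Finset ℤ} {Z Z' : tracelessOps d A}
    (hZ : IsCommAt Φ Ψ A Z) (hZ' : IsCommAt Φ Ψ A Z') : Z = Z' := by
  obtain ⟨B, hB⟩ := hZ
  obtain ⟨B', hB'⟩ := hZ'
  have h : A ⊆ A ∪ (B ∪ B') := Finset.subset_union_left
  have h1 : B ⊆ A ∪ (B ∪ B') := Finset.subset_union_left.trans Finset.subset_union_right
  have h2 : B' ⊆ A ∪ (B ∪ B') := Finset.subset_union_right.trans Finset.subset_union_right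
  rw [← hB _ h1 h, ← hB' _ h2 h]

/-- For local `Φ` the commutator is well defined. -/
theorem isCommAt_comm {n : ℕ} {Φ : FormalOp d} (hΦ : AtMostLocal n Φ) (Ψ : FormalOp d)
    (A : Finset ℤ) : IsCommAt Φ Ψ A (comm Φ Ψ A) := by
  have h := exists_isCommAt hΦ Ψ A
  rw [comm, dif_pos h]
  exact h.choose_spec

end WellDefined

/-- The translate `A + x` of a set of sites. -/
def shiftSet (A : Finset ℤ) (x : ℤ) : Finset ℤ := A.map (addRightEmbedding x)

/-- The translate to `A + x` of an operator on `A`. -/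
def shiftOp {d : ℕ} {A : Finset ℤ} (x : ℤ) (X : Op d A) : Op d (shiftSet A x) :=
  X.submatrix (fun σ a => σ ⟨a.1 + x, Finset.mem_map_of_mem (addRightEmbedding x) a.2⟩)
    (fun σ a => σ ⟨a.1 + x, Finset.mem_map_of_mem (addRightEmbedding x) a.2⟩)

def IsTranslationInvariant {d : ℕ} (Φ : FormalOp d) : Prop :=
  ∀ (A : Finset ℤ) (x : ℤ), (Φ (shiftSet A x) : Op d (shiftSet A x)) = shiftOp x (Φ A : Op d A)

def IsHermitian {d : ℕ} (Φ : FormalOp d) : Prop :=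
  ∀ A, (Φ A : Op d A).IsHermitian

/-- The formal sum `∑_{j ∈ ℤ} Φ_j`, for families such that for each `A` only finitely many of the
`Φ_j(A)` are nonzero. -/
noncomputable def formalSum {d : ℕ} (Φ : ℤ → FormalOp d) : FormalOp d := fun A => ∑ᶠ j, Φ j A

/-- `h⁽²⁾_j + h⁽¹⁾_j`, the terms of the Hamiltonian attached to the site `j`. -/
noncomputable def siteTerm {d : ℕ} (h2 : (j : ℤ) → tracelessOps d {j, j + 1})
    (h1 : (j : ℤ) → tracelessOps d {j}) (j : ℤ) : FormalOp d :=
  Pi.single {j, j + 1} (h2 j) + Pi.single {j} (h1 j)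

/-- The Hamiltonian `H = ∑_j (h⁽²⁾_j + h⁽¹⁾_j)`. -/
noncomputable def hamiltonian {d : ℕ} (h2 : (j : ℤ) → tracelessOps d {j, j + 1})
    (h1 : (j : ℤ) → tracelessOps d {j}) : FormalOp d :=
  formalSum (siteTerm h2 h1)

/-- The boost operator `∑_j j (h⁽²⁾_j + h⁽¹⁾_j) + C`. -/
noncomputable def boost {d : ℕ} (h2 : (j : ℤ) → tracelessOps d {j, j + 1})
    (h1 : (j : ℤ) → tracelessOps d {j}) (C : FormalOp d) : FormalOp d :=
  formalSum (fun j => (j : ℂ) • siteTerm h2 h1 j) + C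

/-- `Q⁽²⁾ = H` and `Q⁽ⁿ⁺¹⁾ = [B, Q⁽ⁿ⁾]` for `n ≥ 2`; the values at `0` and `1` are not used. -/
noncomputable def charge {d : ℕ} [NeZero d] (H B : FormalOp d) : ℕ → FormalOp d
  | 0 => 0
  | 1 => 0
  | 2 => H
  | n + 3 => comm B (charge H B (n + 2))

end SpinChain

/-!
A local formal operator `Φ` acts as a derivation `ad Φ` on the algebra of operators of finite
support, and formal operators are linear functionals on that algebra through the normalized trace,
with `[Φ, Ψ]` the functional `-Ψ ∘ ad Φ`. This yields the Jacobi identity for local `Φ`, `Ψ` and an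
arbitrary third operator.

Translating `B_H` by `x` changes it by a multiple of `H`, so `[B_H, Q]` is translation invariant
whenever `Q` is and `[H, Q] = 0`. Two applications of the Jacobi identity turn `[H, Q⁽³⁾] = 0` and
`[H, Q⁽ⁿ⁾] = 0` into `[H, [H, Q⁽ⁿ⁺¹⁾]] = 0`. For a Hermitian translation invariant `H`, `ad H` is
self-adjoint for the inner product `X, Y ↦ tr (X* Y)` per site, so `[H, Q]` has norm zero as soon as
`[H, [H, Q]] = 0`; this forces `[H, Q] = 0`. Hence all charges are conserved, and the Jacobi
identity gives `[Q⁽ᵐ⁺¹⁾, Q⁽ⁿ⁾] = [B_H, [Q⁽ᵐ⁾, Q⁽ⁿ⁾]] - [Q⁽ᵐ⁾, Q⁽ⁿ⁺¹⁾]`, so they commute by induction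
on `m`.
-/

namespace SpinChain

section TracialAlgebra

variable {R 𝒜 : Type*} [CommRing R] [Ring 𝒜] [Algebra R 𝒜]

/-- `τ` is a trace whose bilinear form `(X, Y) ↦ τ (X * Y)` is nondegenerate. -/
structure IsNondegTrace (τ : 𝒜 →ₗ[R] R) : Prop where
  mul_comm : ∀ X Y, τ (X * Y) = τ (Y * X)
  eq_zero : ∀ X, (∀ Y, τ (Y * X) = 0) → X = 0

/-- `δ` is the commutator with the possibly infinite operator `Φ` that is only known through the
functional `φ = τ (Φ * ·)`: formally, `τ (Y * [Φ, X]) = τ (Φ * [X, Y])`. -/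
def IsAd (τ φ : 𝒜 →ₗ[R] R) (δ : Module.End R 𝒜) : Prop :=
  ∀ X Y, τ (Y * δ X) = φ ⁅X, Y⁆

variable {τ φ ψ : 𝒜 →ₗ[R] R} {δ ε : Module.End R 𝒜}

theorem IsNondegTrace.ext (hτ : IsNondegTrace τ) {X Y : 𝒜}
    (h : ∀ Z, τ (Z * X) = τ (Z * Y)) : X = Y :=
  sub_eq_zero.1 <| hτ.eq_zero _ fun Z => by rw [mul_sub, map_sub, h, sub_self]

theorem IsNondegTrace.trace_lie_mul (hτ : IsNondegTrace τ) (X Y Z : 𝒜) :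
    τ (⁅X, Y⁆ * Z) = τ (X * ⁅Y, Z⁆) := by
  simp only [Ring.lie_def, sub_mul, mul_sub, map_sub, mul_assoc]
  rw [← mul_assoc X Z, hτ.mul_comm (X * Z)]

theorem IsAd.unique (hτ : IsNondegTrace τ) (hδ : IsAd τ φ δ) (hε : IsAd τ φ ε) : δ = ε :=
  LinearMap.ext fun X => hτ.ext fun Y => by rw [hδ, hε]

theorem IsAd.add (hδ : IsAd τ φ δ) (hε : IsAd τ ψ ε) : IsAd τ (φ + ψ) (δ + ε) := fun X Y => by
  rw [LinearMap.add_apply, mul_add, map_add, hδ, hε, LinearMap.add_apply]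

theorem IsAd.smul (hδ : IsAd τ φ δ) (c : R) : IsAd τ (c • φ) (c • δ) := fun X Y => by
  rw [LinearMap.smul_apply, mul_smul_comm, map_smul, hδ, LinearMap.smul_apply]

theorem IsAd.trace_apply (hδ : IsAd τ φ δ) (X : 𝒜) : τ (δ X) = 0 := by
  simpa [Ring.lie_def] using hδ X 1

theorem IsAd.trace_mul_apply (hδ : IsAd τ φ δ) (X Y : 𝒜) : τ (Y * δ X) = -τ (X * δ Y) := by
  rw [hδ, hδ, ← map_neg, Ring.lie_def, Ring.lie_def, neg_sub]

theorem IsAd.leibniz (hτ : IsNondegTrace τ) (hδ : IsAd τ φ δ) (X Y : 𝒜) :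
    δ (X * Y) = δ X * Y + X * δ Y := by
  refine hτ.ext fun Z => ?_
  have cyclic : ⁅X * Y, Z⁆ = ⁅X, Y * Z⁆ + ⁅Y, Z * X⁆ := by
    simp only [Ring.lie_def]
    noncomm_ring
  rw [hδ, cyclic, map_add, ← hδ, ← hδ, mul_add, map_add, ← mul_assoc Z, hτ.mul_comm (Z * δ X),
    mul_assoc Y, mul_assoc Z]

theorem IsAd.lie (hτ : IsNondegTrace τ) (hδ : IsAd τ φ δ) (hε : IsAd τ ψ ε) :
    IsAd τ (-(ψ ∘ₗ δ)) ⁅δ, ε⁆ := by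
  intro X Y
  have hδε : τ (Y * δ (ε X)) = -ψ ⁅X, δ Y⁆ := by
    rw [hδ.trace_mul_apply, hτ.mul_comm, hε]
  have hεδ : τ (Y * ε (δ X)) = ψ ⁅δ X, Y⁆ := hε _ _
  have hδXY : δ ⁅X, Y⁆ = ⁅δ X, Y⁆ + ⁅X, δ Y⁆ := by
    simp only [Ring.lie_def, map_sub, hδ.leibniz hτ]
    abel
  rw [Ring.lie_def, LinearMap.sub_apply, Module.End.mul_apply, Module.End.mul_apply, mul_sub,
    map_sub, hδε, hεδ, LinearMap.neg_apply, LinearMap.comp_apply, hδXY, map_add]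
  ring

theorem IsAd.map_apply (hτ : IsNondegTrace τ) {α : 𝒜 →ₐ[R] 𝒜} (hα : Function.Surjective α)
    (hτα : ∀ X, τ (α X) = τ X) (hδ : IsAd τ φ δ) (hε : IsAd τ (φ ∘ₗ α.toLinearMap) ε) (X : 𝒜) :
    α (ε X) = δ (α X) := by
  refine hτ.ext fun Y => ?_
  obtain ⟨Y, rfl⟩ := hα Y
  rw [← map_mul, hτα, hε, hδ]
  simp [Ring.lie_def]

end TracialAlgebra

section ChainOp

variable {d : ℕ} {A B : Finset ℤ}

/-- The product operator on `A` whose factors are taken from a family of one-site operators on the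
whole chain; letting the family not depend on `A` makes restriction to subregions free. -/
def chainOp (A : Finset ℤ) (X : ℤ → Matrix (Fin d) (Fin d) ℂ) : Op d A := prodOp fun a => X a.1

theorem chainOp_congr {X Y : ℤ → Matrix (Fin d) (Fin d) ℂ} (h : ∀ a ∈ A, X a = Y a) :
    chainOp A X = chainOp A Y :=
  congrArg prodOp (funext fun a => h a.1 a.2)

theorem prodOp_eq_chainOp (X : A → Matrix (Fin d) (Fin d) ℂ) :
    prodOp X = chainOp A fun a => if h : a ∈ A then X ⟨a, h⟩ else 0 := by
  simp [chainOp]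

theorem chainOp_apply_comp (X : ℤ → Matrix (Fin d) (Fin d) ℂ) (σ σ' : ℤ → Fin d) :
    chainOp A X (σ ∘ Subtype.val) (σ' ∘ Subtype.val) = ∏ a ∈ A, X a (σ a) (σ' a) :=
  Finset.prod_coe_sort A fun a => X a (σ a) (σ' a)

theorem chainOp_mul (X Y : ℤ → Matrix (Fin d) (Fin d) ℂ) :
    chainOp A X * chainOp A Y = chainOp A fun a => X a * Y a := prodOp_mul _ _

theorem chainOp_one (A : Finset ℤ) : chainOp A (fun _ => 1) = (1 : Op d A) := by
  ext σ σ'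
  simp [chainOp, prodOp, Matrix.one_apply, Finset.prod_ite_zero, funext_iff]

theorem chainOp_smul (c : ℤ → ℂ) (X : ℤ → Matrix (Fin d) (Fin d) ℂ) :
    chainOp A (fun a => c a • X a) = (∏ a ∈ A, c a) • chainOp A X := by
  ext σ σ'
  simp only [chainOp, prodOp, Matrix.of_apply, Matrix.smul_apply, smul_eq_mul,
    Finset.prod_mul_distrib, Finset.prod_coe_sort A c]

theorem chainOp_add [NeZero d] (X Y : ℤ → Matrix (Fin d) (Fin d) ℂ) :
    chainOp B (fun b => X b + Y b) =
      ∑ A ∈ B.powerset, chainOp B fun b => if b ∈ A then X b else Y b := by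
  have extend : Function.Surjective fun (σ : ℤ → Fin d) => σ ∘ (Subtype.val : B → ℤ) :=
    Subtype.val_injective.surjective_comp_right
  ext σ σ'
  obtain ⟨σ, rfl⟩ := extend σ
  obtain ⟨σ', rfl⟩ := extend σ'
  rw [Matrix.sum_apply, chainOp_apply_comp]
  simp only [Matrix.add_apply, Finset.prod_add, chainOp_apply_comp]
  refine Finset.sum_congr rfl fun A hA => ?_
  rw [← Finset.prod_sdiff (Finset.mem_powerset.1 hA), mul_comm]
  congr 1
  · exact Finset.prod_congr rfl fun b hb => by rw [if_neg (Finset.mem_sdiff.1 hb).2]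
  · exact Finset.prod_congr rfl fun b hb => by rw [if_pos hb]

theorem span_chainOp (A : Finset ℤ) :
    Submodule.span ℂ (Set.range (chainOp (d := d) A)) = ⊤ := by
  rw [eq_top_iff, ← span_prodOp, Submodule.span_le]
  rintro _ ⟨X, rfl⟩
  exact Submodule.subset_span ⟨_, (prodOp_eq_chainOp X).symm⟩

theorem linearMap_ext_chainOp {M : Type*} [AddCommGroup M] [Module ℂ M] {τ : ℂ →+* ℂ}
    {f g : Op d A →ₛₗ[τ] M} (h : ∀ X, f (chainOp A X) = g (chainOp A X)) : f = g :=
  LinearMap.ext_on_range (span_chainOp A) h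

theorem bilinearMap_ext_chainOp {M : Type*} [AddCommGroup M] [Module ℂ M]
    {f g : Op d A →ₗ[ℂ] Op d B →ₗ[ℂ] M}
    (h : ∀ X Y, f (chainOp A X) (chainOp B Y) = g (chainOp A X) (chainOp B Y)) : f = g :=
  linearMap_ext_chainOp fun X => linearMap_ext_chainOp (h X)

theorem chainOp_mem_tracelessOps {X : ℤ → Matrix (Fin d) (Fin d) ℂ}
    (hX : ∀ a ∈ A, (X a).trace = 0) : chainOp A X ∈ tracelessOps d A :=
  Submodule.subset_span ⟨_, fun a => hX a.1 a.2, rfl⟩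

theorem tracelessOps_le {S : Submodule ℂ (Op d A)}
    (h : ∀ X : ℤ → Matrix (Fin d) (Fin d) ℂ, (∀ a, (X a).trace = 0) → chainOp A X ∈ S) :
    tracelessOps d A ≤ S := by
  refine Submodule.span_le.2 ?_
  rintro _ ⟨X, hX, rfl⟩
  rw [SetLike.mem_coe, prodOp_eq_chainOp]
  refine h _ fun a => ?_
  split_ifs
  · exact hX _
  · exact Matrix.trace_zero _ _

end ChainOp

section Embedding

variable {d : ℕ} {A B C : Finset ℤ}

theorem embed_chainOp (h : A ⊆ B) (X : ℤ → Matrix (Fin d) (Fin d) ℂ) :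
    embed h (chainOp A X) = chainOp B fun b => if b ∈ A then X b else 1 := by
  rw [chainOp, embed_prodOp]
  simp [chainOp]

/-- `embed` as a linear map, for extensionality arguments; its multiplicativity is proved that
way. -/
def embedₗ (h : A ⊆ B) : Op d A →ₗ[ℂ] Op d B where
  toFun := embed h
  map_add' := embed_add h
  map_smul' := embed_smul h

theorem embed_one (h : A ⊆ B) : embed h (1 : Op d A) = 1 := by
  rw [← chainOp_one, embed_chainOp, ← chainOp_one]
  exact chainOp_congr fun a _ => ite_self 1

theorem embed_mul (h : A ⊆ B) (X Y : Op d A) : embed h (X * Y) = embed h X * embed h Y := by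
  have : (LinearMap.mul ℂ (Op d A)).compr₂ (embedₗ h) =
      (LinearMap.mul ℂ (Op d B)).compl₁₂ (embedₗ h) (embedₗ h) := by
    refine bilinearMap_ext_chainOp fun X Y => ?_
    change embed h (chainOp A X * chainOp A Y) = embed h (chainOp A X) * embed h (chainOp A Y)
    simp only [chainOp_mul, embed_chainOp]
    exact chainOp_congr fun a _ => by split_ifs <;> simp
  exact LinearMap.congr_fun₂ this X Y

/-- `X ↦ X ⊗ 1` as a homomorphism of algebras. The inclusion is stated with `≤` to fit the direct
limit over all finite regions. -/
def embedHom (A B : Finset ℤ) (h : A ≤ B) : Op d A →ₐ[ℂ] Op d B :=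
  AlgHom.ofLinearMap (embedₗ h) (embed_one h) (embed_mul h)

theorem embed_embed (h : A ⊆ B) (h' : B ⊆ C) (X : Op d A) :
    embed h' (embed h X) = embed (h.trans h') X := by
  refine LinearMap.congr_fun (f := embedₗ h' ∘ₗ embedₗ h) (g := embedₗ (h.trans h'))
    (linearMap_ext_chainOp fun X => ?_) X
  change embed h' (embed h (chainOp A X)) = embed (h.trans h') (chainOp A X)
  simp only [embed_chainOp]
  exact chainOp_congr fun a _ => by by_cases ha : a ∈ A <;> simp [ha, @h a]

theorem embed_self (h : A ⊆ A) (X : Op d A) : embed h X = X := by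
  ext σ σ'
  exact if_pos fun a ha => absurd a.2 ha

theorem embed_mul_comm_of_disjoint (hA : A ⊆ B) (hC : C ⊆ B) (hAC : Disjoint A C)
    (X : Op d A) (Y : Op d C) : embed hA X * embed hC Y = embed hC Y * embed hA X := by
  have : (LinearMap.mul ℂ (Op d B)).compl₁₂ (embedₗ hA) (embedₗ hC) =
      (LinearMap.mul ℂ (Op d B)).flip.compl₁₂ (embedₗ hA) (embedₗ hC) := by
    refine bilinearMap_ext_chainOp fun X Y => ?_
    change embed hA (chainOp A X) * embed hC (chainOp C Y) =
      embed hC (chainOp C Y) * embed hA (chainOp A X)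
    simp only [embed_chainOp, chainOp_mul]
    refine chainOp_congr fun b _ => ?_
    by_cases hb : b ∈ A
    · simp [hb, Finset.disjoint_left.1 hAC hb]
    · simp [hb]
  exact LinearMap.congr_fun₂ this X Y

theorem embed_conjTranspose (h : A ⊆ B) (X : Op d A) :
    embed h X.conjTranspose = (embed h X).conjTranspose := by
  ext σ σ'
  simp only [embed, Matrix.conjTranspose_apply, Matrix.of_apply, eq_comm, apply_ite star, star_zero]

theorem chainOp_conjTranspose (X : ℤ → Matrix (Fin d) (Fin d) ℂ) :
    (chainOp A X).conjTranspose = chainOp A fun a => (X a).conjTranspose := by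
  ext σ σ'
  simp [chainOp, prodOp, Matrix.conjTranspose_apply]

theorem conjTranspose_mem_tracelessOps {X : Op d A} (hX : X ∈ tracelessOps d A) :
    X.conjTranspose ∈ tracelessOps d A := by
  have : tracelessOps d A ≤
      (tracelessOps d A).comap (Matrix.conjTransposeLinearEquiv _ _ ℂ ℂ).toLinearMap :=
    tracelessOps_le fun X hX => by
      change (chainOp A X).conjTranspose ∈ tracelessOps d A
      rw [chainOp_conjTranspose]
      exact chainOp_mem_tracelessOps fun a _ => by rw [Matrix.trace_conjTranspose, hX, star_zero]
  exact this hX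

end Embedding

section NormalizedTrace

variable {d : ℕ} {A B C : Finset ℤ}

/-- The trace of the operators on `A`, normalized by `tr 1 = 1` so that it does not depend on the
region. -/
noncomputable def normTrace (A : Finset ℤ) : Op d A →ₗ[ℂ] ℂ :=
  ((d : ℂ) ^ A.card)⁻¹ • Matrix.traceLinearMap (A → Fin d) ℂ ℂ

theorem normTrace_apply (X : Op d A) : normTrace A X = ((d : ℂ) ^ A.card)⁻¹ * X.trace := rfl

theorem normTrace_chainOp (X : ℤ → Matrix (Fin d) (Fin d) ℂ) :
    normTrace A (chainOp A X) = ∏ a ∈ A, (X a).trace / d := by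
  rw [normTrace_apply, Finset.prod_div_distrib, Finset.prod_const, div_eq_inv_mul,
    ← Finset.prod_coe_sort]
  simp only [Matrix.trace, Matrix.diag, chainOp, prodOp, Matrix.of_apply]
  rw [Finset.prod_univ_sum, Fintype.piFinset_univ]

theorem normTrace_mul_comm (X Y : Op d A) : normTrace A (X * Y) = normTrace A (Y * X) := by
  rw [normTrace_apply, Matrix.trace_mul_comm, normTrace_apply]

theorem normTrace_embed_mul_embed_eq_zero (hA : A ⊆ B) (hC : C ⊆ B) (hAC : ¬ A ⊆ C)
    {X : Op d A} (hX : X ∈ tracelessOps d A) (Y : Op d C) :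
    normTrace B (embed hA X * embed hC Y) = 0 := by
  obtain ⟨b, hbA, hbC⟩ := Finset.not_subset.1 hAC
  let f : Op d A →ₗ[ℂ] Op d C →ₗ[ℂ] ℂ :=
    ((LinearMap.mul ℂ (Op d B)).compl₁₂ (embedₗ hA) (embedₗ hC)).compr₂ (normTrace B)
  have hf : tracelessOps d A ≤ f.ker := tracelessOps_le fun X hX => by
    refine LinearMap.mem_ker.2 (linearMap_ext_chainOp fun Y => ?_)
    change normTrace B (embed hA (chainOp A X) * embed hC (chainOp C Y)) = 0
    rw [embed_chainOp, embed_chainOp, chainOp_mul, normTrace_chainOp]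
    exact Finset.prod_eq_zero (hA hbA) (by simp [hbA, hbC, hX])
  exact LinearMap.congr_fun (LinearMap.mem_ker.1 (hf hX)) Y

open scoped ComplexOrder in
theorem normTrace_mul_conjTranspose_nonneg (X : Op d A) :
    0 ≤ normTrace A (X * X.conjTranspose) := by
  rw [normTrace_apply]
  exact mul_nonneg (by positivity) (Matrix.posSemidef_self_mul_conjTranspose X).trace_nonneg

variable [NeZero d]

theorem normTrace_embed (h : A ⊆ B) (X : Op d A) : normTrace B (embed h X) = normTrace A X := by
  have hd : (d : ℂ) ≠ 0 := NeZero.ne _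
  refine LinearMap.congr_fun (f := normTrace B ∘ₗ embedₗ h) (linearMap_ext_chainOp fun X => ?_) X
  change normTrace B (embed h (chainOp A X)) = _
  rw [embed_chainOp, normTrace_chainOp, normTrace_chainOp, ← Finset.prod_subset h]
  · exact Finset.prod_congr rfl fun a ha => by rw [if_pos ha]
  · exact fun a _ ha => by simp [ha, hd]

open scoped ComplexOrder in
theorem normTrace_mul_conjTranspose_eq_zero {X : Op d A} :
    normTrace A (X * X.conjTranspose) = 0 ↔ X = 0 := by
  have hd : (d : ℂ) ≠ 0 := NeZero.ne _
  rw [normTrace_apply, mul_eq_zero, Matrix.trace_mul_conjTranspose_self_eq_zero_iff]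
  simp [hd]

end NormalizedTrace

section Components

variable {d : ℕ} {A B : Finset ℤ}

theorem tracelessPart_conjTranspose (X : Matrix (Fin d) (Fin d) ℂ) :
    (tracelessPart X).conjTranspose = tracelessPart X.conjTranspose := by
  simp [tracelessPart, Matrix.conjTranspose_sub, Matrix.trace_conjTranspose]

variable [NeZero d]

theorem component_chainOp (h : A ⊆ B) (X : ℤ → Matrix (Fin d) (Fin d) ℂ) :
    (component h (chainOp B X) : Op d A) =
      (∏ b ∈ B, if b ∈ A then 1 else (X b).trace / d) • chainOp A fun a => tracelessPart (X a) := by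
  rw [chainOp, component_prodOp, ← Finset.prod_coe_sort B]
  rfl

/-- `component` as a linear map, for extensionality arguments. -/
noncomputable def componentₗ (h : A ⊆ B) : Op d B →ₗ[ℂ] Op d A where
  toFun Y := component h Y
  map_add' Y Z := congrArg Subtype.val (component_add h Y Z)
  map_smul' c Y := congrArg Subtype.val (component_smul h c Y)

theorem sum_embed_component (Y : Op d B) :
    ∑ A : {A : Finset ℤ // A ∈ B.powerset}, embed (Finset.mem_powerset.1 A.2)
      (component (Finset.mem_powerset.1 A.2) Y : Op d A.1) = Y := by
  have : ∑ A : {A : Finset ℤ // A ∈ B.powerset}, embedₗ (Finset.mem_powerset.1 A.2) ∘ₗ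
      componentₗ (Finset.mem_powerset.1 A.2) = (LinearMap.id : Op d B →ₗ[ℂ] Op d B) := by
    refine linearMap_ext_chainOp fun X => ?_
    have expand : chainOp B X = ∑ A ∈ B.powerset, chainOp B fun b =>
        if b ∈ A then tracelessPart (X b) else ((X b).trace / d) • 1 := by
      rw [← chainOp_add]
      exact chainOp_congr fun b _ => (sub_add_cancel _ _).symm
    rw [LinearMap.sum_apply, LinearMap.id_apply]
    refine Eq.trans ?_ expand.symm
    rw [← Finset.sum_coe_sort B.powerset]
    refine Finset.sum_congr rfl fun A _ => ?_
    change embed (Finset.mem_powerset.1 A.2)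
      (component (Finset.mem_powerset.1 A.2) (chainOp B X) : Op d A.1) = _
    rw [component_chainOp, embed_smul, embed_chainOp, ← chainOp_smul]
    exact chainOp_congr fun b _ => by split_ifs <;> simp
  have hY := LinearMap.congr_fun this Y
  rwa [LinearMap.sum_apply] at hY

theorem component_conjTranspose (h : A ⊆ B) (X : Op d B) :
    (component h X.conjTranspose : Op d A) = (component h X : Op d A).conjTranspose := by
  refine LinearMap.congr_fun
    (f := componentₗ h ∘ₛₗ (Matrix.conjTransposeLinearEquiv _ _ ℂ ℂ).toLinearMap)
    (g := (Matrix.conjTransposeLinearEquiv _ _ ℂ ℂ).toLinearMap ∘ₛₗ componentₗ h)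
    (linearMap_ext_chainOp fun X => ?_) X
  change (component h (chainOp B X).conjTranspose : Op d A) =
    (component h (chainOp B X) : Op d A).conjTranspose
  simp only [chainOp_conjTranspose, component_chainOp, Matrix.conjTranspose_smul,
    tracelessPart_conjTranspose, star_prod]
  congr 1
  exact Finset.prod_congr rfl fun b _ => by split_ifs <;> simp [Matrix.trace_conjTranspose]

end Components

section LocalAlgebra

open Function

variable {d : ℕ} {A B C : Finset ℤ}

instance : DirectedSystem (Op d) (fun _ _ h => embedHom (d := d) _ _ h) where
  map_self _ X := embed_self subset_rfl X
  map_map _ _ _ hAB hBC X := embed_embed hAB hBC X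

/-- The algebra of operators with finite support, the union of the operators on finite regions. -/
def LocalAlg (d : ℕ) : Type := DirectLimit (Op d) (embedHom (d := d))

noncomputable instance : Ring (LocalAlg d) :=
  inferInstanceAs (Ring (DirectLimit (Op d) (embedHom (d := d))))

noncomputable instance : Algebra ℂ (LocalAlg d) :=
  inferInstanceAs (Algebra ℂ (DirectLimit (Op d) (embedHom (d := d))))

/-- The inclusion of the operators on `A` into the operators with finite support. -/
noncomputable def ofOp (A : Finset ℤ) : Op d A →ₐ[ℂ] LocalAlg d :=
  AlgHom.ofLinearMap (DirectLimit.Module.of ℂ (Finset ℤ) (Op d) embedHom A)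
    (DirectLimit.one_def (f := embedHom (d := d)) A).symm
    fun X Y => (DirectLimit.mul_def (f := embedHom (d := d)) A X Y).symm

theorem ofOp_embed (h : A ⊆ B) (X : Op d A) : ofOp B (embed h X) = ofOp A X :=
  DirectLimit.Module.of_f (R := ℂ) (f := embedHom (d := d)) (hij := h)

theorem exists_eq_ofOp (X : LocalAlg d) : ∃ A X', X = ofOp A X' :=
  DirectLimit.exists_eq_mk _ X

theorem exists_eq_ofOp₂ (X Y : LocalAlg d) : ∃ A X' Y', X = ofOp A X' ∧ Y = ofOp A Y' :=
  DirectLimit.exists_eq_mk₂ _ X Y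

theorem ofOp_lie_of_disjoint (h : Disjoint A C) (X : Op d A) (Y : Op d C) :
    ⁅ofOp A X, ofOp C Y⁆ = 0 := by
  rw [Ring.lie_def, ← ofOp_embed Finset.subset_union_left X,
    ← ofOp_embed Finset.subset_union_right Y, ← map_mul, embed_mul_comm_of_disjoint _ _ h, map_mul,
    sub_self]

theorem restrict_zero (B : Finset ℤ) : restrict (0 : FormalOp d) B = 0 :=
  Finset.sum_eq_zero fun _ _ => embed_zero _

theorem ofOp_restrict (Φ : FormalOp d) (B : Finset ℤ) :
    ofOp B (restrict Φ B) = ∑ A ∈ B.powerset, ofOp A (Φ A : Op d A) := by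
  rw [restrict, map_sum, ← Finset.sum_coe_sort B.powerset]
  exact Finset.sum_congr rfl fun A _ => ofOp_embed _ _

variable [NeZero d]

/-- The normalized trace of an operator with finite support. -/
noncomputable def locTrace : LocalAlg d →ₗ[ℂ] ℂ :=
  DirectLimit.Module.lift ℂ (Finset ℤ) (Op d) embedHom normTrace
    fun _ _ h X => normTrace_embed h X

theorem locTrace_ofOp (X : Op d A) : locTrace (ofOp A X) = normTrace A X := rfl

theorem isNondegTrace_locTrace : IsNondegTrace (locTrace (d := d)) where
  mul_comm X Y := by
    obtain ⟨A, X, Y, rfl, rfl⟩ := exists_eq_ofOp₂ X Y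
    rw [← map_mul, ← map_mul, locTrace_ofOp, locTrace_ofOp, normTrace_mul_comm]
  eq_zero X h := by
    obtain ⟨A, X, rfl⟩ := exists_eq_ofOp X
    have hX := h (ofOp A X.conjTranspose)
    rw [← map_mul, locTrace_ofOp, normTrace_mul_comm, normTrace_mul_conjTranspose_eq_zero] at hX
    rw [hX, map_zero]

theorem locTrace_ofOp_mul_ofOp_eq_zero (h : ¬ A ⊆ C) (X : tracelessOps d A) (Y : Op d C) :
    locTrace (ofOp A (X : Op d A) * ofOp C Y) = 0 := by
  rw [← ofOp_embed Finset.subset_union_left (X : Op d A),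
    ← ofOp_embed Finset.subset_union_right Y, ← map_mul, locTrace_ofOp,
    normTrace_embed_mul_embed_eq_zero _ _ h X.2]

theorem support_locTrace_mul_ofOp_subset (Φ : FormalOp d) (Y : Op d C) :
    support (fun A => locTrace (ofOp A (Φ A : Op d A) * ofOp C Y)) ⊆ C.powerset := fun A hA =>
  Finset.mem_coe.2 <| Finset.mem_powerset.2 <| by
    contrapose! hA
    simp [locTrace_ofOp_mul_ofOp_eq_zero hA]

theorem hasFiniteSupport_locTrace_mul (Φ : FormalOp d) (X : LocalAlg d) :
    HasFiniteSupport fun A => locTrace (ofOp A (Φ A : Op d A) * X) := by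
  obtain ⟨C, Y, rfl⟩ := exists_eq_ofOp X
  exact (Finset.finite_toSet _).subset (support_locTrace_mul_ofOp_subset Φ Y)

/-- The pairing `(Φ, X) ↦ tr (Φ X)` of formal operators with operators of finite support; only the
finitely many terms `Φ(A)` with `A` in the support of `X` contribute. -/
noncomputable def pairing : FormalOp d →ₗ[ℂ] LocalAlg d →ₗ[ℂ] ℂ :=
  LinearMap.mk₂ ℂ (fun Φ X => ∑ᶠ A, locTrace (ofOp A (Φ A : Op d A) * X))
    (fun Φ Ψ X => by
      rw [← finsum_add_distrib (hasFiniteSupport_locTrace_mul Φ X)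
        (hasFiniteSupport_locTrace_mul Ψ X)]
      simp [add_mul])
    (fun c Φ X => by simp [smul_eq_mul, mul_finsum])
    (fun Φ X Y => by
      rw [← finsum_add_distrib (hasFiniteSupport_locTrace_mul Φ X)
        (hasFiniteSupport_locTrace_mul Φ Y)]
      simp [mul_add])
    (fun c Φ X => by simp [smul_eq_mul, mul_finsum])

theorem pairing_apply (Φ : FormalOp d) (X : LocalAlg d) :
    pairing Φ X = ∑ᶠ A, locTrace (ofOp A (Φ A : Op d A) * X) := rfl

theorem pairing_ofOp_eq_sum (Φ : FormalOp d) (X : Op d B) :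
    pairing Φ (ofOp B X) = ∑ A ∈ B.powerset, locTrace (ofOp A (Φ A : Op d A) * ofOp B X) :=
  finsum_eq_sum_of_support_subset _ (support_locTrace_mul_ofOp_subset Φ X)

theorem pairing_ofOp (Φ : FormalOp d) (X : Op d B) :
    pairing Φ (ofOp B X) = locTrace (ofOp B (restrict Φ B) * ofOp B X) := by
  rw [pairing_ofOp_eq_sum, ofOp_restrict, Finset.sum_mul, map_sum]

theorem pairing_ofOp_of_mem_tracelessOps (Φ : FormalOp d) {X : Op d A}
    (hX : X ∈ tracelessOps d A) : pairing Φ (ofOp A X) = normTrace A ((Φ A : Op d A) * X) := by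
  rw [pairing_ofOp_eq_sum, Finset.sum_eq_single_of_mem A (Finset.mem_powerset_self A), ← map_mul,
    locTrace_ofOp]
  intro C hC hCA
  rw [isNondegTrace_locTrace.mul_comm]
  exact locTrace_ofOp_mul_ofOp_eq_zero
    (fun h => hCA ((Finset.mem_powerset.1 hC).antisymm h)) ⟨X, hX⟩ (Φ C : Op d C)

theorem pairing_injective : Injective (pairing (d := d)) := by
  refine (injective_iff_map_eq_zero _).2 fun Φ hΦ => funext fun A => Subtype.ext ?_
  have := pairing_ofOp_of_mem_tracelessOps Φ (conjTranspose_mem_tracelessOps (Φ A).2)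
  rwa [hΦ, LinearMap.zero_apply, eq_comm, normTrace_mul_conjTranspose_eq_zero] at this

end LocalAlgebra

section Locality

variable {d : ℕ} {A : Finset ℤ} {n m : ℕ} {Φ Ψ : FormalOp d}

/-- A formal operator is local if its terms act on a bounded number of contiguous sites. -/
def IsLocal (Φ : FormalOp d) : Prop := ∃ n, AtMostLocal n Φ

theorem AtMostLocal.isLocal (h : AtMostLocal n Φ) : IsLocal Φ := ⟨n, h⟩

theorem AtMostLocal.mono (h : AtMostLocal n Φ) (hnm : n ≤ m) : AtMostLocal m Φ :=
  fun A hA => (h A hA).trans hnm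

theorem AtMostLocal.add (hΦ : AtMostLocal n Φ) (hΨ : AtMostLocal n Ψ) : AtMostLocal n (Φ + Ψ) :=
  fun A hA => by
    by_cases h : Φ A = 0
    · exact hΨ A fun h' => hA (by rw [Pi.add_apply, h, h', add_zero])
    · exact hΦ A h

theorem AtMostLocal.smul (c : ℂ) (hΦ : AtMostLocal n Φ) : AtMostLocal n (c • Φ) :=
  fun A hA => hΦ A fun h => hA (by rw [Pi.smul_apply, h, smul_zero])

theorem IsLocal.add (hΦ : IsLocal Φ) (hΨ : IsLocal Ψ) : IsLocal (Φ + Ψ) := by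
  obtain ⟨n, hΦ⟩ := hΦ
  obtain ⟨m, hΨ⟩ := hΨ
  exact ⟨max n m, (hΦ.mono (le_max_left n m)).add (hΨ.mono (le_max_right n m))⟩

theorem IsLocal.smul (c : ℂ) (hΦ : IsLocal Φ) : IsLocal (c • Φ) := hΦ.imp fun _ => .smul c

theorem setRange_le_iff : setRange A ≤ n ↔ ∀ a ∈ A, ∀ b ∈ A, b - a + 1 ≤ n := by
  rw [setRange]
  split_ifs with hA
  · refine ⟨fun h a ha b hb => ?_, fun h => ?_⟩
    · have := A.le_max' b hb
      have := A.min'_le a ha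
      omega
    · have := h _ (A.min'_mem hA) _ (A.max'_mem hA)
      omega
  · simp [Finset.not_nonempty_iff_eq_empty.1 hA]

theorem IsLocal.exists_neighborhood (hΦ : IsLocal Φ) (D : Finset ℤ) :
    ∃ B, D ⊆ B ∧ ∀ A, Φ A ≠ 0 → ¬ Disjoint A D → A ⊆ B := by
  obtain ⟨n, hΦ⟩ := hΦ
  refine ⟨D.biUnion fun a => Finset.Icc (a - n) (a + n), fun a ha =>
    Finset.mem_biUnion.2 ⟨a, ha, Finset.mem_Icc.2 (by omega)⟩, fun A hA hAD b hb => ?_⟩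
  obtain ⟨a, haA, haD⟩ := Finset.not_disjoint_iff.1 hAD
  have hab := setRange_le_iff.1 (hΦ A hA)
  have := hab a haA b hb
  have := hab b hb a haA
  exact Finset.mem_biUnion.2 ⟨a, haD, Finset.mem_Icc.2 (by omega)⟩

end Locality

section Derivation

open Function

variable {d : ℕ} {B D : Finset ℤ} {Φ : FormalOp d}

theorem support_ofOp_lie_subset (hB : ∀ A, Φ A ≠ 0 → ¬ Disjoint A D → A ⊆ B) (X : Op d D) :
    support (fun A => ⁅ofOp A (Φ A : Op d A), ofOp D X⁆) ⊆ B.powerset := fun A hA =>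
  Finset.mem_coe.2 <| Finset.mem_powerset.2 <| hB A
    (fun h => hA (by simp [h, Ring.lie_def])) fun h => hA (ofOp_lie_of_disjoint h _ X)

theorem IsLocal.hasFiniteSupport_ofOp_lie (hΦ : IsLocal Φ) (X : LocalAlg d) :
    HasFiniteSupport fun A => ⁅ofOp A (Φ A : Op d A), X⁆ := by
  obtain ⟨D, X, rfl⟩ := exists_eq_ofOp X
  obtain ⟨B, -, hB⟩ := hΦ.exists_neighborhood D
  exact (Finset.finite_toSet _).subset (support_ofOp_lie_subset hB X)

/-- The derivation `X ↦ [Φ, X]` of the operators of finite support defined by a local formal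
operator. -/
noncomputable def ad (hΦ : IsLocal Φ) : Module.End ℂ (LocalAlg d) where
  toFun X := ∑ᶠ A, ⁅ofOp A (Φ A : Op d A), X⁆
  map_add' X Y := by
    rw [← finsum_add_distrib (hΦ.hasFiniteSupport_ofOp_lie X) (hΦ.hasFiniteSupport_ofOp_lie Y)]
    exact finsum_congr fun A => by simp only [Ring.lie_def]; noncomm_ring
  map_smul' c X := by
    rw [RingHom.id_apply, smul_finsum' c (hΦ.hasFiniteSupport_ofOp_lie X)]
    exact finsum_congr fun A => by
      simp only [Ring.lie_def, mul_smul_comm, smul_mul_assoc, ← smul_sub]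

theorem ad_apply (hΦ : IsLocal Φ) (X : LocalAlg d) :
    ad hΦ X = ∑ᶠ A, ⁅ofOp A (Φ A : Op d A), X⁆ := rfl

theorem ad_ofOp (hΦ : IsLocal Φ) (hB : ∀ A, Φ A ≠ 0 → ¬ Disjoint A D → A ⊆ B) (X : Op d D) :
    ad hΦ (ofOp D X) = ⁅ofOp B (restrict Φ B), ofOp D X⁆ := by
  rw [ad_apply, finsum_eq_sum_of_support_subset _ (support_ofOp_lie_subset hB X), ofOp_restrict]
  simp only [Ring.lie_def, Finset.sum_mul, Finset.mul_sum, Finset.sum_sub_distrib]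

variable [NeZero d]

theorem isAd_ad (hΦ : IsLocal Φ) : IsAd locTrace (pairing Φ) (ad hΦ) := by
  intro X Y
  have hτ := isNondegTrace_locTrace (d := d)
  have hfin : HasFiniteSupport fun A => ⁅ofOp A (Φ A : Op d A), X⁆ :=
    hΦ.hasFiniteSupport_ofOp_lie X
  calc locTrace (Y * ad hΦ X) = (locTrace ∘ₗ LinearMap.mulRight ℂ Y) (ad hΦ X) :=
        hτ.mul_comm _ _
    _ = ∑ᶠ A, (locTrace ∘ₗ LinearMap.mulRight ℂ Y) ⁅ofOp A (Φ A : Op d A), X⁆ :=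
        map_finsum _ hfin
    _ = pairing Φ ⁅X, Y⁆ := finsum_congr fun A => by
        rw [LinearMap.comp_apply, LinearMap.mulRight_apply, hτ.trace_lie_mul]

end Derivation

section Commutator

variable {d : ℕ} [NeZero d] {A : Finset ℤ} {Φ Ψ : FormalOp d}

theorem IsCommAt.comm_eq {Z : tracelessOps d A} (h : IsCommAt Φ Ψ A Z) : comm Φ Ψ A = Z := by
  have hex : ∃ Z, IsCommAt Φ Ψ A Z := ⟨Z, h⟩
  rw [comm, dif_pos hex]
  exact hex.choose_spec.unique h

theorem IsLocal.isCommAt_comm (hΦ : IsLocal Φ) (Ψ : FormalOp d) (A : Finset ℤ) :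
    IsCommAt Φ Ψ A (comm Φ Ψ A) :=
  hΦ.elim fun _ h => SpinChain.isCommAt_comm h Ψ A

theorem component_zero {B : Finset ℤ} (h : A ⊆ B) : component h (0 : Op d B) = 0 := by
  simpa using component_sub h (0 : Op d B) 0

theorem comm_zero (Φ : FormalOp d) : comm Φ 0 = 0 :=
  funext fun _ => IsCommAt.comm_eq ⟨∅, fun B _ h => by
    rw [restrict_zero, mul_zero, zero_mul, sub_zero, component_zero, Pi.zero_apply]⟩

theorem zero_comm (Ψ : FormalOp d) : comm 0 Ψ = 0 :=
  funext fun _ => IsCommAt.comm_eq ⟨∅, fun B _ h => by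
    rw [restrict_zero, mul_zero, zero_mul, sub_zero, component_zero, Pi.zero_apply]⟩

theorem comm_self (Φ : FormalOp d) : comm Φ Φ = 0 :=
  funext fun _ => IsCommAt.comm_eq ⟨∅, fun B _ h => by
    rw [sub_self, component_zero, Pi.zero_apply]⟩

/-- An operator on a finite region as a formal operator. -/
noncomputable def toFormalOp {B : Finset ℤ} (Y : Op d B) : FormalOp d := fun A =>
  if h : A ⊆ B then component h Y else 0

theorem restrict_toFormalOp {B : Finset ℤ} (Y : Op d B) : restrict (toFormalOp Y) B = Y := by
  conv_rhs => rw [← sum_embed_component Y]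
  exact Finset.sum_congr rfl fun A _ => by rw [toFormalOp, dif_pos (Finset.mem_powerset.1 A.2)]

theorem pairing_ofOp_congr {D : Finset ℤ} (h : ∀ A ⊆ D, Φ A = Ψ A) (X : Op d D) :
    pairing Φ (ofOp D X) = pairing Ψ (ofOp D X) := by
  rw [pairing_ofOp_eq_sum, pairing_ofOp_eq_sum]
  exact Finset.sum_congr rfl fun A hA => by rw [h A (Finset.mem_powerset.1 hA)]

theorem pairing_toFormalOp {B D : Finset ℤ} (h : D ⊆ B) (Y : Op d B) (X : Op d D) :
    pairing (toFormalOp Y) (ofOp D X) = locTrace (ofOp B Y * ofOp D X) := by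
  rw [← ofOp_embed h, pairing_ofOp, restrict_toFormalOp]

theorem pairing_comm (hΦ : IsLocal Φ) (Ψ : FormalOp d) :
    pairing (comm Φ Ψ) = -(pairing Ψ ∘ₗ ad hΦ) := by
  ext X
  obtain ⟨D, X, rfl⟩ := exists_eq_ofOp X
  obtain ⟨B₁, hDB₁, hB₁⟩ := hΦ.exists_neighborhood D
  choose B₂ hB₂ using hΦ.isCommAt_comm Ψ
  let B := B₁ ∪ D.powerset.biUnion B₂
  have hDB : D ⊆ B := hDB₁.trans Finset.subset_union_left
  let Y := restrict Φ B * restrict Ψ B - restrict Ψ B * restrict Φ B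
  have hY : ∀ A ⊆ D, comm Φ Ψ A = toFormalOp Y A := fun A hA => by
    rw [toFormalOp, dif_pos (hA.trans hDB)]
    exact (hB₂ A B ((Finset.subset_biUnion_of_mem B₂ (Finset.mem_powerset.2 hA)).trans
      Finset.subset_union_right) _).symm
  have hτ := isNondegTrace_locTrace (d := d)
  have had : ad hΦ (ofOp D X) = ⁅ofOp B (restrict Φ B), ofOp D X⁆ :=
    ad_ofOp hΦ (fun A hA hAD => (hB₁ A hA hAD).trans Finset.subset_union_left) X
  calc pairing (comm Φ Ψ) (ofOp D X) = locTrace (ofOp B Y * ofOp D X) := by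
        rw [pairing_ofOp_congr hY, pairing_toFormalOp hDB]
    _ = -locTrace (⁅ofOp B (restrict Ψ B), ofOp B (restrict Φ B)⁆ * ofOp D X) := by
        simp only [Y, Ring.lie_def, map_sub, map_mul, sub_mul, neg_sub]
    _ = -locTrace (ofOp B (restrict Ψ B) * ad hΦ (ofOp D X)) := by rw [hτ.trace_lie_mul, had]
    _ = -pairing Ψ (ad hΦ (ofOp D X)) := by
        rw [had, ← ofOp_embed hDB, Ring.lie_def, ← map_mul, ← map_mul, ← map_sub, pairing_ofOp]

theorem comm_neg (hΦ : IsLocal Φ) (Ψ : FormalOp d) : comm Φ (-Ψ) = -comm Φ Ψ :=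
  pairing_injective <| by
    rw [pairing_comm hΦ, map_neg, map_neg, pairing_comm hΦ, LinearMap.neg_comp]

theorem add_smul_comm (hΦ : IsLocal Φ) (hΨ : IsLocal Ψ) (c : ℂ) (Ω : FormalOp d) :
    comm (Φ + c • Ψ) Ω = comm Φ Ω + c • comm Ψ Ω := by
  have hτ := isNondegTrace_locTrace (d := d)
  have had : ad (hΦ.add (hΨ.smul c)) = ad hΦ + c • ad hΨ := by
    refine IsAd.unique hτ (isAd_ad _) ?_
    rw [map_add, map_smul]
    exact (isAd_ad hΦ).add ((isAd_ad hΨ).smul c)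
  refine pairing_injective ?_
  rw [pairing_comm (hΦ.add (hΨ.smul c)), had, map_add, map_smul, pairing_comm hΦ, pairing_comm hΨ,
    LinearMap.comp_add, LinearMap.comp_smul, neg_add, smul_neg]

theorem exists_of_comm_ne_zero (hΦ : IsLocal Φ) (h : comm Φ Ψ A ≠ 0) :
    ∃ P P', Φ P ≠ 0 ∧ Ψ P' ≠ 0 ∧ ¬ Disjoint P P' ∧ ¬ Disjoint P A ∧ A ⊆ P ∪ P' := by
  have hτ := isNondegTrace_locTrace (d := d)
  let X : tracelessOps d A :=
    ⟨(comm Φ Ψ A : Op d A).conjTranspose, conjTranspose_mem_tracelessOps (comm Φ Ψ A).2⟩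
  have hX : pairing Ψ (ad hΦ (ofOp A X)) ≠ 0 := by
    rw [← neg_ne_zero, ← LinearMap.comp_apply, ← LinearMap.neg_apply, ← pairing_comm,
      pairing_ofOp_of_mem_tracelessOps _ X.2, Ne, normTrace_mul_conjTranspose_eq_zero]
    exact fun h' => h (Subtype.ext h')
  rw [ad_apply, map_finsum _ (hΦ.hasFiniteSupport_ofOp_lie _)] at hX
  obtain ⟨P, hP⟩ := not_forall.1 (mt finsum_eq_zero_of_forall_eq_zero hX)
  obtain ⟨P', hP'⟩ := not_forall.1 (mt finsum_eq_zero_of_forall_eq_zero hP)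
  have hPA : ¬ Disjoint P A := fun h => hP' (by
    rw [ofOp_lie_of_disjoint h, mul_zero, map_zero])
  rw [← hτ.trace_lie_mul] at hP'
  refine ⟨P, P', ?_, ?_, ?_, ?_, ?_⟩
  · exact fun h => hP' (by simp [h, Ring.lie_def])
  · exact fun h => hP' (by simp [h, Ring.lie_def])
  · exact fun h => hP' (by rw [ofOp_lie_of_disjoint h.symm, zero_mul, map_zero])
  · exact hPA
  · contrapose! hP'
    rw [hτ.mul_comm, ← ofOp_embed Finset.subset_union_left (Φ P : Op d P),
      ← ofOp_embed (Finset.subset_union_right (s₁ := P)) (Ψ P' : Op d P'), Ring.lie_def, ← map_mul,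
      ← map_mul, ← map_sub]
    exact locTrace_ofOp_mul_ofOp_eq_zero hP' X _

theorem comm_empty (hΦ : IsLocal Φ) (Ψ : FormalOp d) : comm Φ Ψ ∅ = 0 := by
  by_contra h
  obtain ⟨P, -, -, -, -, hP, -⟩ := exists_of_comm_ne_zero hΦ h
  exact hP (Finset.disjoint_empty_right P)

theorem AtMostLocal.comm {n m : ℕ} (hΦ : AtMostLocal (n + 1) Φ) (hΨ : AtMostLocal m Ψ) :
    AtMostLocal (n + m) (comm Φ Ψ) := by
  intro A hA
  obtain ⟨P, P', hP, hP', hPP', -, hAPP'⟩ := exists_of_comm_ne_zero hΦ.isLocal hA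
  obtain ⟨c, hc, hc'⟩ := Finset.not_disjoint_iff.1 hPP'
  have hrP := setRange_le_iff.1 (hΦ P hP)
  have hrP' := setRange_le_iff.1 (hΨ P' hP')
  refine setRange_le_iff.2 fun a ha b hb => ?_
  rcases Finset.mem_union.1 (hAPP' ha) with ha | ha <;>
    rcases Finset.mem_union.1 (hAPP' hb) with hb | hb <;> push_cast at *
  · linarith [hrP a ha b hb, hrP' c hc' c hc']
  · linarith [hrP a ha c hc, hrP' c hc' b hb]
  · linarith [hrP' a ha c hc', hrP c hc b hb]
  · linarith [hrP' a ha b hb, hrP c hc c hc]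

theorem IsLocal.comm (hΦ : IsLocal Φ) (hΨ : IsLocal Ψ) : IsLocal (comm Φ Ψ) := by
  obtain ⟨n, hΦ⟩ := hΦ
  obtain ⟨m, hΨ⟩ := hΨ
  exact ((hΦ.mono n.le_succ).comm hΨ).isLocal

theorem ad_comm (hΦ : IsLocal Φ) (hΨ : IsLocal Ψ) :
    ad (hΦ.comm hΨ) = ⁅ad hΦ, ad hΨ⁆ := by
  have hτ := isNondegTrace_locTrace (d := d)
  refine IsAd.unique hτ (isAd_ad _) ?_
  rw [pairing_comm hΦ]
  exact (isAd_ad hΦ).lie hτ (isAd_ad hΨ)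

theorem comm_comm (hΦ : IsLocal Φ) (hΨ : IsLocal Ψ) (Ω : FormalOp d) :
    comm (comm Φ Ψ) Ω = comm Φ (comm Ψ Ω) - comm Ψ (comm Φ Ω) := by
  refine pairing_injective ?_
  rw [pairing_comm (hΦ.comm hΨ), ad_comm hΦ hΨ, map_sub, pairing_comm hΦ, pairing_comm hΨ,
    pairing_comm hΨ, pairing_comm hΦ]
  ext X
  simp only [Ring.lie_def, LinearMap.neg_apply, LinearMap.comp_apply, LinearMap.sub_apply,
    Module.End.mul_apply, map_sub]
  ring

end Commutator

section Translation

variable {d : ℕ} {A B : Finset ℤ} {x : ℤ} {Φ Ψ : FormalOp d}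

theorem mem_shiftSet {a : ℤ} : a ∈ shiftSet A x ↔ a - x ∈ A := by
  simp only [shiftSet, Finset.mem_map, addRightEmbedding_apply]
  exact ⟨fun ⟨b, hb, h⟩ => by rwa [← h, add_sub_cancel_right], fun h => ⟨_, h, sub_add_cancel _ _⟩⟩

theorem shiftSet_mono (h : A ⊆ B) (x : ℤ) : shiftSet A x ⊆ shiftSet B x := Finset.map_subset_map.2 h

theorem shiftSet_neg_shiftSet (A : Finset ℤ) (x : ℤ) : shiftSet (shiftSet A (-x)) x = A := by
  ext a
  simp only [mem_shiftSet, sub_neg_eq_add, sub_add_cancel]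

/-- Translation by `x` of the operators on `A`, as an isomorphism of algebras; its underlying
function is `shiftOp`. -/
noncomputable def shiftEquiv (A : Finset ℤ) (x : ℤ) : Op d A ≃ₐ[ℂ] Op d (shiftSet A x) :=
  Matrix.reindexAlgEquiv ℂ ℂ ((A.equivMap (addRightEmbedding x)).arrowCongr (Equiv.refl _))

theorem shiftEquiv_chainOp (X : ℤ → Matrix (Fin d) (Fin d) ℂ) :
    shiftEquiv A x (chainOp A X) = chainOp (shiftSet A x) fun a => X (a - x) := by
  ext σ σ'
  refine Fintype.prod_equiv (A.equivMap (addRightEmbedding x)) _ _ fun a => ?_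
  change _ = X (a + x - x) _ _
  rw [add_sub_cancel_right]
  rfl

theorem shiftEquiv_embed (h : A ⊆ B) (X : Op d A) :
    shiftEquiv B x (embed h X) = embed (shiftSet_mono h x) (shiftEquiv A x X) := by
  refine LinearMap.congr_fun (f := (shiftEquiv B x).toLinearMap ∘ₗ embedₗ h)
    (g := embedₗ (shiftSet_mono h x) ∘ₗ (shiftEquiv A x).toLinearMap)
    (linearMap_ext_chainOp fun X => ?_) X
  change shiftEquiv B x (embed h (chainOp A X)) =
    embed (shiftSet_mono h x) (shiftEquiv A x (chainOp A X))
  simp only [embed_chainOp, shiftEquiv_chainOp, mem_shiftSet]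

theorem normTrace_shiftEquiv (X : Op d A) :
    normTrace (shiftSet A x) (shiftEquiv A x X) = normTrace A X := by
  have hcard : (shiftSet A x).card = A.card := Finset.card_map _
  rw [normTrace_apply, normTrace_apply, hcard]
  exact congrArg _ (Equiv.sum_comp _ fun σ => X σ σ)

theorem shiftEquiv_symm_mem_tracelessOps {X : Op d (shiftSet A x)}
    (hX : X ∈ tracelessOps d (shiftSet A x)) : (shiftEquiv A x).symm X ∈ tracelessOps d A := by
  have : tracelessOps d (shiftSet A x) ≤
      (tracelessOps d A).comap (shiftEquiv A x).symm.toLinearMap := tracelessOps_le fun X hX => by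
    have : shiftEquiv A x (chainOp A fun a => X (a + x)) = chainOp (shiftSet A x) X := by
      simp only [shiftEquiv_chainOp, sub_add_cancel]
    change (shiftEquiv A x).symm (chainOp (shiftSet A x) X) ∈ tracelessOps d A
    rw [← this, AlgEquiv.symm_apply_apply]
    exact chainOp_mem_tracelessOps fun a _ => hX _
  exact this hX

/-- Translation by `x` of the operators of finite support. -/
noncomputable def shiftAlg (x : ℤ) : LocalAlg d →ₐ[ℂ] LocalAlg d :=
  let f : LocalAlg d →ₗ[ℂ] LocalAlg d := DirectLimit.Module.lift ℂ (Finset ℤ) (Op d) embedHom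
    (fun A => (ofOp (shiftSet A x)).toLinearMap ∘ₗ (shiftEquiv A x).toLinearMap)
    fun _ _ h X => (congrArg (ofOp _) (shiftEquiv_embed h X)).trans (ofOp_embed _ _)
  have hf : ∀ (A : Finset ℤ) (X : Op d A), f (ofOp A X) = ofOp _ (shiftEquiv A x X) :=
    fun _ _ => rfl
  AlgHom.ofLinearMap f (by rw [← map_one (ofOp (d := d) ∅), hf, map_one, map_one, map_one])
    fun X Y => by
      obtain ⟨A, X, Y, rfl, rfl⟩ := exists_eq_ofOp₂ X Y
      rw [← map_mul, hf, hf, hf, map_mul, map_mul]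

theorem shiftAlg_ofOp (X : Op d A) :
    shiftAlg x (ofOp A X) = ofOp (shiftSet A x) (shiftEquiv A x X) := rfl

theorem shiftAlg_surjective (x : ℤ) : Function.Surjective (shiftAlg (d := d) x) := by
  intro Y
  obtain ⟨A, Y, rfl⟩ := exists_eq_ofOp Y
  obtain ⟨A, rfl⟩ : ∃ D, A = shiftSet D x := ⟨_, (shiftSet_neg_shiftSet A x).symm⟩
  obtain ⟨X, rfl⟩ := (shiftEquiv A x).surjective Y
  exact ⟨ofOp A X, rfl⟩

/-- The translate of a formal operator by `-x`: its value at `A` is `Φ(A + x)` moved back to `A`.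
Translating backwards avoids a cast along `(A - x) + x = A`. -/
noncomputable def unshift (x : ℤ) (Φ : FormalOp d) : FormalOp d := fun A =>
  ⟨(shiftEquiv A x).symm (Φ (shiftSet A x) : Op d _), shiftEquiv_symm_mem_tracelessOps (Φ _).2⟩

theorem shiftEquiv_unshift (x : ℤ) (Φ : FormalOp d) (A : Finset ℤ) :
    shiftEquiv A x (unshift x Φ A : Op d A) = Φ (shiftSet A x) := AlgEquiv.apply_symm_apply _ _

theorem unshift_eq_iff : unshift x Φ = Ψ ↔
    ∀ A, (Φ (shiftSet A x) : Op d (shiftSet A x)) = shiftEquiv A x (Ψ A : Op d A) := by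
  rw [funext_iff]
  exact forall_congr' fun A => Subtype.ext_iff.trans (AlgEquiv.symm_apply_eq _)

theorem isTranslationInvariant_iff_unshift_eq :
    IsTranslationInvariant Φ ↔ ∀ x, unshift x Φ = Φ :=
  forall_comm.trans (forall_congr' fun _ => unshift_eq_iff.symm)

/-- `B` is a boost of `H`: translating `B` by `-x` adds `x • H`, as for `∑ j • hⱼ` with
`H = ∑ hⱼ`. -/
def IsBoost (H B : FormalOp d) : Prop := ∀ x, unshift x B = B + (x : ℂ) • H

variable [NeZero d]

theorem locTrace_shiftAlg (x : ℤ) (X : LocalAlg d) : locTrace (shiftAlg x X) = locTrace X := by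
  obtain ⟨A, X, rfl⟩ := exists_eq_ofOp X
  rw [shiftAlg_ofOp, locTrace_ofOp, locTrace_ofOp, normTrace_shiftEquiv]

theorem pairing_unshift (x : ℤ) (Φ : FormalOp d) :
    pairing (unshift x Φ) = pairing Φ ∘ₗ (shiftAlg x).toLinearMap := by
  ext X
  rw [LinearMap.comp_apply, AlgHom.toLinearMap_apply, pairing_apply, pairing_apply,
    ← finsum_comp_equiv (Equiv.addRight x).finsetCongr
      (f := fun A => locTrace (ofOp A (Φ A : Op d A) * _))]
  refine finsum_congr fun A => ?_
  change _ = locTrace (ofOp (shiftSet A x) (Φ (shiftSet A x) : Op d _) * shiftAlg x X)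
  rw [← shiftEquiv_unshift, ← shiftAlg_ofOp, ← map_mul, locTrace_shiftAlg]

theorem shiftAlg_ad_unshift (hΦ : IsLocal Φ) (h : IsLocal (unshift x Φ)) (X : LocalAlg d) :
    shiftAlg x (ad h X) = ad hΦ (shiftAlg x X) :=
  IsAd.map_apply isNondegTrace_locTrace (shiftAlg_surjective x) (locTrace_shiftAlg x) (isAd_ad hΦ)
    (pairing_unshift x Φ ▸ isAd_ad h) X

theorem unshift_comm (hΦ : IsLocal Φ) (h : IsLocal (unshift x Φ)) (Ψ : FormalOp d) :
    unshift x (comm Φ Ψ) = comm (unshift x Φ) (unshift x Ψ) := by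
  refine pairing_injective ?_
  ext X
  rw [pairing_unshift, pairing_comm hΦ, pairing_comm h, pairing_unshift]
  simp only [LinearMap.neg_apply, LinearMap.comp_apply, AlgHom.toLinearMap_apply,
    shiftAlg_ad_unshift hΦ h]

theorem IsTranslationInvariant.shiftAlg_ad (hinv : IsTranslationInvariant Φ) (hΦ : IsLocal Φ)
    (x : ℤ) (X : LocalAlg d) : shiftAlg x (ad hΦ X) = ad hΦ (shiftAlg x X) := by
  have h := isTranslationInvariant_iff_unshift_eq.1 hinv x
  have := shiftAlg_ad_unshift (x := x) hΦ (h.symm ▸ hΦ) X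
  simpa only [h] using this

theorem IsTranslationInvariant.comm (hinv : IsTranslationInvariant Φ) (hΦ : IsLocal Φ)
    (hΨ : IsTranslationInvariant Ψ) : IsTranslationInvariant (comm Φ Ψ) :=
  isTranslationInvariant_iff_unshift_eq.2 fun x => by
    have h := isTranslationInvariant_iff_unshift_eq.1 hinv x
    rw [unshift_comm hΦ (h.symm ▸ hΦ), h, isTranslationInvariant_iff_unshift_eq.1 hΨ]

theorem IsBoost.isTranslationInvariant_comm {H : FormalOp d} (h : IsBoost H Φ) (hH : IsLocal H)
    (hΦ : IsLocal Φ) (hΨ : IsTranslationInvariant Ψ) (hHΨ : comm H Ψ = 0) :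
    IsTranslationInvariant (comm Φ Ψ) :=
  isTranslationInvariant_iff_unshift_eq.2 fun x => by
    rw [unshift_comm hΦ (h x ▸ hΦ.add (hH.smul x)), h,
      isTranslationInvariant_iff_unshift_eq.1 hΨ, add_smul_comm hΦ hH, hHΨ, smul_zero, add_zero]

end Translation

section Adjoint

variable {d : ℕ} {Φ : FormalOp d}

/-- The adjoint of a formal operator, taken termwise. -/
def adjoint (Φ : FormalOp d) : FormalOp d := fun A =>
  ⟨(Φ A : Op d A).conjTranspose, conjTranspose_mem_tracelessOps (Φ A).2⟩

theorem adjoint_apply (Φ : FormalOp d) (A : Finset ℤ) :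
    (adjoint Φ A : Op d A) = (Φ A : Op d A).conjTranspose := rfl

theorem adjoint_apply_eq_zero_iff {A : Finset ℤ} : adjoint Φ A = 0 ↔ Φ A = 0 := by
  rw [← Subtype.coe_inj, ← Subtype.coe_inj, adjoint_apply]
  exact Matrix.conjTranspose_eq_zero

theorem IsLocal.adjoint (hΦ : IsLocal Φ) : IsLocal (adjoint Φ) :=
  hΦ.imp fun _ h A hA => h A (mt adjoint_apply_eq_zero_iff.2 hA)

theorem IsHermitian.adjoint_eq (hΦ : IsHermitian Φ) : adjoint Φ = Φ :=
  funext fun A => Subtype.ext (hΦ A)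

theorem IsTranslationInvariant.adjoint (hΦ : IsTranslationInvariant Φ) :
    IsTranslationInvariant (adjoint Φ) := by
  intro A x
  rw [adjoint_apply, adjoint_apply, hΦ]
  rfl

theorem restrict_adjoint (Φ : FormalOp d) (B : Finset ℤ) :
    restrict (adjoint Φ) B = (restrict Φ B).conjTranspose := by
  simp only [restrict, Matrix.conjTranspose_sum, adjoint_apply, embed_conjTranspose]

theorem adjoint_zero : adjoint (0 : FormalOp d) = 0 :=
  funext fun _ => Subtype.ext Matrix.conjTranspose_zero

theorem comm_adjoint [NeZero d] (hΦ : IsLocal Φ) (Ψ : FormalOp d) :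
    comm (adjoint Φ) (adjoint Ψ) = -adjoint (comm Φ Ψ) := by
  funext A
  obtain ⟨B₀, hB₀⟩ := hΦ.isCommAt_comm Ψ A
  refine IsCommAt.comm_eq ⟨B₀, fun B h h' => Subtype.ext ?_⟩
  rw [restrict_adjoint, restrict_adjoint, ← Matrix.conjTranspose_mul, ← Matrix.conjTranspose_mul,
    ← Matrix.conjTranspose_sub, component_conjTranspose, Pi.neg_apply, Submodule.coe_neg,
    adjoint_apply, ← hB₀ B h h', component_sub, component_sub, ← Matrix.conjTranspose_neg,
    ← Submodule.coe_neg, neg_sub]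

end Adjoint

section Semisimplicity

open Function

variable {d : ℕ} {H Φ : FormalOp d}

theorem shiftAlg_shiftAlg_neg (x : ℤ) (X : LocalAlg d) : shiftAlg x (shiftAlg (-x) X) = X := by
  obtain ⟨A, X, rfl⟩ := exists_eq_ofOp X
  refine LinearMap.congr_fun (g := (ofOp A).toLinearMap) (f := (shiftAlg x).toLinearMap ∘ₗ
    (shiftAlg (-x)).toLinearMap ∘ₗ (ofOp A).toLinearMap) (linearMap_ext_chainOp fun X => ?_) X
  change shiftAlg x (shiftAlg (-x) (ofOp A (chainOp A X))) = ofOp A (chainOp A X)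
  simp only [shiftAlg_ofOp, shiftEquiv_chainOp, sub_neg_eq_add, sub_add_cancel]
  exact congrArg (fun D => ofOp D (chainOp D X)) (shiftSet_neg_shiftSet A x)

theorem ofOp_empty (X : Op d ∅) : ofOp ∅ X = normTrace ∅ X • (1 : LocalAlg d) := by
  have hX : X = normTrace ∅ X • (1 : Op d ∅) := by
    ext σ σ'
    rw [Subsingleton.elim σ' σ]
    simpa [normTrace_apply, Matrix.trace] using
      congrArg₂ X (Subsingleton.elim _ _) (Subsingleton.elim _ _)
  conv_lhs => rw [hX, map_smul, map_one]

/-- The sum over the site `x` of the terms of `Φ` containing `x`, each divided by the number of its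
sites; summing over all sites gives back `Φ`, up to `Φ(∅)`. -/
noncomputable def siteDensity (Φ : FormalOp d) (x : ℤ) : LocalAlg d :=
  ∑ᶠ A, if x ∈ A then (A.card : ℂ)⁻¹ • ofOp A (Φ A : Op d A) else 0

theorem IsLocal.finite_setOf_mem (hΦ : IsLocal Φ) (x : ℤ) : {A | x ∈ A ∧ Φ A ≠ 0}.Finite := by
  obtain ⟨B, -, hB⟩ := hΦ.exists_neighborhood {x}
  refine (Finset.finite_toSet B.powerset).subset fun A hA => ?_
  refine Finset.mem_coe.2 (Finset.mem_powerset.2 (hB A hA.2 ?_))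
  rw [Finset.disjoint_singleton_right, not_not]
  exact hA.1

theorem IsLocal.map_siteDensity {M : Type*} [AddCommGroup M] [Module ℂ M] (hΦ : IsLocal Φ)
    (f : LocalAlg d →ₗ[ℂ] M) (x : ℤ) : f (siteDensity Φ x) =
      ∑ᶠ A, if x ∈ A then (A.card : ℂ)⁻¹ • f (ofOp A (Φ A : Op d A)) else 0 := by
  rw [siteDensity, map_finsum f]
  · simp only [apply_ite f, map_smul, map_zero]
  · refine (hΦ.finite_setOf_mem x).subset fun A hA => ⟨by_contra fun h => hA (if_neg h), ?_⟩
    exact fun h => hA (by simp [h])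

theorem shiftAlg_siteDensity (hΦ : IsLocal Φ) (hinv : IsTranslationInvariant Φ) (x y : ℤ) :
    shiftAlg y (siteDensity Φ x) = siteDensity Φ (x + y) := by
  refine (hΦ.map_siteDensity (shiftAlg y).toLinearMap x).trans ?_
  rw [siteDensity, ← finsum_comp_equiv (Equiv.addRight y).finsetCongr
    (f := fun A => if x + y ∈ A then (A.card : ℂ)⁻¹ • ofOp A (Φ A : Op d A) else 0)]
  refine finsum_congr fun A => ?_
  change _ = if x + y ∈ shiftSet A y then
    ((shiftSet A y).card : ℂ)⁻¹ • ofOp (shiftSet A y) (Φ (shiftSet A y) : Op d _) else 0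
  have hcard : (shiftSet A y).card = A.card := Finset.card_map _
  rw [hinv, hcard]
  simp only [mem_shiftSet, add_sub_cancel_right]
  rfl

variable [NeZero d]

/-- The correlation `∑ₓ tr ((X translated by x) Y)` of two operators of finite support. It
pairs `Y` with the translation invariant formal operator generated by `X`. -/
noncomputable def translateForm (X Y : LocalAlg d) : ℂ := ∑ᶠ x : ℤ, locTrace (shiftAlg x X * Y)

theorem translateForm_comm (X Y : LocalAlg d) : translateForm X Y = translateForm Y X := by
  rw [translateForm, ← finsum_comp_equiv (Equiv.neg ℤ)]
  refine finsum_congr fun x => ?_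
  rw [Equiv.neg_apply, ← locTrace_shiftAlg x, map_mul, shiftAlg_shiftAlg_neg,
    isNondegTrace_locTrace.mul_comm]

theorem translateForm_ad (hΦ : IsLocal Φ) (hinv : IsTranslationInvariant Φ) (X Y : LocalAlg d) :
    translateForm (ad hΦ X) Y = -translateForm X (ad hΦ Y) := by
  have hτ := isNondegTrace_locTrace (d := d)
  rw [translateForm, translateForm, ← finsum_neg_distrib]
  refine finsum_congr fun x => ?_
  rw [hinv.shiftAlg_ad, hτ.mul_comm, (isAd_ad hΦ).trace_mul_apply]

theorem locTrace_siteDensity_mul_ofOp {C : Finset ℤ} (hΦ : IsLocal Φ) (x : ℤ) (Y : Op d C) :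
    locTrace (siteDensity Φ x * ofOp C Y) = ∑ A ∈ C.powerset,
      if x ∈ A then (A.card : ℂ)⁻¹ * locTrace (ofOp A (Φ A : Op d A) * ofOp C Y) else 0 := by
  refine (hΦ.map_siteDensity (locTrace ∘ₗ LinearMap.mulRight ℂ (ofOp C Y)) x).trans ?_
  refine finsum_eq_sum_of_support_subset _ fun A hA =>
    support_locTrace_mul_ofOp_subset Φ Y fun h => hA ?_
  simp only [LinearMap.comp_apply, LinearMap.mulRight_apply, h, smul_zero, ite_self]

theorem translateForm_siteDensity (hΦ : IsLocal Φ) (hinv : IsTranslationInvariant Φ) (x : ℤ)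
    (Y : LocalAlg d) :
    translateForm (siteDensity Φ x) Y = ∑ᶠ y, locTrace (siteDensity Φ y * Y) := by
  rw [translateForm, ← finsum_comp_equiv (Equiv.addLeft x)
    (f := fun y => locTrace (siteDensity Φ y * Y))]
  exact finsum_congr fun y => by rw [shiftAlg_siteDensity hΦ hinv]; rfl

theorem pairing_eq_add_translateForm (hΦ : IsLocal Φ) (hinv : IsTranslationInvariant Φ) (x : ℤ)
    (Y : LocalAlg d) : pairing Φ Y =
      normTrace ∅ (Φ ∅ : Op d ∅) * locTrace Y + translateForm (siteDensity Φ x) Y := by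
  obtain ⟨C, Y, rfl⟩ := exists_eq_ofOp Y
  let t : Finset ℤ → ℂ := fun A => locTrace (ofOp A (Φ A : Op d A) * ofOp C Y)
  have hform : translateForm (siteDensity Φ x) (ofOp C Y) =
      ∑ y ∈ C, ∑ A ∈ C.powerset, if y ∈ A then (A.card : ℂ)⁻¹ * t A else 0 := by
    rw [translateForm_siteDensity hΦ hinv, finsum_eq_sum_of_support_subset (s := C)]
    · exact Finset.sum_congr rfl fun y _ => locTrace_siteDensity_mul_ofOp hΦ y Y
    · intro y hy
      rw [mem_support, locTrace_siteDensity_mul_ofOp hΦ] at hy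
      obtain ⟨A, hA, hyA⟩ := Finset.exists_ne_zero_of_sum_ne_zero hy
      exact Finset.mem_powerset.1 hA (by_contra fun h => hyA (if_neg h))
  have hcount : ∀ A ∈ C.powerset, A ≠ ∅ →
      ∑ y ∈ C, (if y ∈ A then (A.card : ℂ)⁻¹ * t A else 0) = t A := fun A hA hA' => by
    rw [Finset.sum_ite_mem, Finset.inter_eq_right.2 (Finset.mem_powerset.1 hA), Finset.sum_const,
      nsmul_eq_mul, mul_inv_cancel_left₀ (Nat.cast_ne_zero.2 (mt Finset.card_eq_zero.1 hA'))]
  have hempty : t ∅ = normTrace ∅ (Φ ∅ : Op d ∅) * locTrace (ofOp C Y) := by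
    simp only [t, ofOp_empty, smul_mul_assoc, one_mul, map_smul, smul_eq_mul]
  rw [hform, Finset.sum_comm, pairing_ofOp_eq_sum, ← hempty,
    ← Finset.add_sum_erase _ _ (Finset.empty_mem_powerset C),
    ← Finset.add_sum_erase _ (fun A => ∑ y ∈ C, _) (Finset.empty_mem_powerset C)]
  simp only [Finset.notMem_empty, if_false, Finset.sum_const_zero, zero_add]
  refine congrArg _ (Finset.sum_congr rfl fun A hA => (hcount A ?_ ?_).symm)
  · exact Finset.mem_of_mem_erase hA
  · exact Finset.ne_of_mem_erase hA

open scoped ComplexOrder in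
theorem eq_zero_of_pairing_siteDensity_adjoint (hΦ : IsLocal Φ) (hempty : Φ ∅ = 0)
    (h : ∀ x, pairing Φ (siteDensity (adjoint Φ) x) = 0) : Φ = 0 := by
  let t : Finset ℤ → ℂ := fun A => normTrace A ((Φ A : Op d A) * (Φ A : Op d A).conjTranspose)
  let s : ℤ → Finset ℤ → ℂ := fun x A => if x ∈ A then (A.card : ℂ)⁻¹ * t A else 0
  have hsum : ∀ x, ∑ᶠ A, s x A = 0 := fun x => by
    rw [← h x, hΦ.adjoint.map_siteDensity]
    exact finsum_congr fun A => by
      rw [pairing_ofOp_of_mem_tracelessOps Φ (adjoint Φ A).2, adjoint_apply, smul_eq_mul]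
  have hnonneg : ∀ x A, 0 ≤ s x A := fun x A =>
    ite_nonneg (mul_nonneg (by positivity) (normTrace_mul_conjTranspose_nonneg _)) le_rfl
  have hfin : ∀ x, HasFiniteSupport (s x) := fun x =>
    (hΦ.finite_setOf_mem x).subset fun A hA =>
      ⟨by_contra fun h => hA (if_neg h), fun h => hA (by simp [s, t, h])⟩
  funext A
  obtain rfl | ⟨x, hx⟩ := A.eq_empty_or_nonempty
  · exact hempty
  have hsA : s x A = 0 :=
    ((single_le_finsum A (hfin x) (hnonneg x)).trans_eq (hsum x)).antisymm (hnonneg x A)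
  have hcard : (A.card : ℂ) ≠ 0 := Nat.cast_ne_zero.2 (Finset.card_ne_zero_of_mem hx)
  have htA : t A = 0 := by simpa [s, hx, hcard] using hsA
  exact Subtype.ext (normTrace_mul_conjTranspose_eq_zero.1 htA)

theorem comm_eq_zero_of_comm_comm_eq_zero (hH : IsLocal H) (hherm : IsHermitian H)
    (hHinv : IsTranslationInvariant H) (hΦ : IsLocal Φ) (hΦinv : IsTranslationInvariant Φ)
    (h : comm H (comm H Φ) = 0) : comm H Φ = 0 := by
  let K := comm H Φ
  have hK : IsLocal K := hH.comm hΦ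
  have hKinv : IsTranslationInvariant (adjoint K) := (hHinv.comm hH hΦinv).adjoint
  have hHK : comm H (adjoint K) = 0 := by
    rw [← hherm.adjoint_eq, comm_adjoint hH, h, adjoint_zero, neg_zero]
  have hform : ∀ {Ψ : FormalOp d} (_ : IsLocal Ψ) (_ : IsTranslationInvariant Ψ) (x : ℤ) (X),
      pairing Ψ (ad hH X) = translateForm (siteDensity Ψ x) (ad hH X) := fun hΨ hΨinv x X => by
    rw [pairing_eq_add_translateForm hΨ hΨinv x, (isAd_ad hH).trace_apply, mul_zero, zero_add]
  refine eq_zero_of_pairing_siteDensity_adjoint hK (comm_empty hH Φ) fun x => ?_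
  let ρ := siteDensity Φ x
  let ρ' := siteDensity (adjoint K) x
  calc pairing K ρ' = -translateForm ρ (ad hH ρ') := by
        rw [pairing_comm hH, LinearMap.neg_apply, LinearMap.comp_apply, hform hΦ hΦinv x]
    _ = translateForm ρ' (ad hH ρ) := by rw [← translateForm_ad hH hHinv, translateForm_comm]
    _ = pairing (adjoint K) (ad hH ρ) := (hform hK.adjoint hKinv x ρ).symm
    _ = -pairing (comm H (adjoint K)) ρ := by
        rw [pairing_comm hH, LinearMap.neg_apply, LinearMap.comp_apply, neg_neg]
    _ = 0 := by rw [hHK, map_zero, LinearMap.zero_apply, neg_zero]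

end Semisimplicity

section Boost

variable {d : ℕ} {h2 : (j : ℤ) → tracelessOps d {j, j + 1}} {h1 : (j : ℤ) → tracelessOps d {j}}
  {C : FormalOp d}

theorem eq_pair_or_eq_singleton_of_siteTerm_ne_zero {j : ℤ} {A : Finset ℤ}
    (h : siteTerm h2 h1 j A ≠ 0) : A = {j, j + 1} ∨ A = {j} := by
  by_contra! hA
  exact h (by simp [siteTerm, Pi.single_eq_of_ne hA.1, Pi.single_eq_of_ne hA.2])

theorem isLeast_of_siteTerm_ne_zero {j : ℤ} {A : Finset ℤ} (h : siteTerm h2 h1 j A ≠ 0) :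
    IsLeast (A : Set ℤ) j := by
  obtain rfl | rfl := eq_pair_or_eq_singleton_of_siteTerm_ne_zero h <;> simp [IsLeast, lowerBounds]

theorem siteTerm_eq_zero_of_ne_sInf {j : ℤ} {A : Finset ℤ} (hj : j ≠ sInf (A : Set ℤ)) :
    siteTerm h2 h1 j A = 0 :=
  by_contra fun h => hj (isLeast_of_siteTerm_ne_zero h).csInf_eq.symm

theorem hamiltonian_apply (A : Finset ℤ) :
    hamiltonian h2 h1 A = siteTerm h2 h1 (sInf (A : Set ℤ)) A :=
  finsum_eq_single _ _ fun _ => siteTerm_eq_zero_of_ne_sInf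

theorem boost_apply (A : Finset ℤ) :
    boost h2 h1 C A = ((sInf (A : Set ℤ) : ℤ) : ℂ) • hamiltonian h2 h1 A + C A := by
  rw [hamiltonian_apply, boost, Pi.add_apply, formalSum, finsum_eq_single _ (sInf (A : Set ℤ)),
    Pi.smul_apply]
  intro j hj
  rw [Pi.smul_apply, siteTerm_eq_zero_of_ne_sInf hj, smul_zero]

theorem eq_pair_or_eq_singleton_of_hamiltonian_ne_zero {A : Finset ℤ}
    (h : hamiltonian h2 h1 A ≠ 0) : ∃ j, A = {j, j + 1} ∨ A = {j} :=
  ⟨_, eq_pair_or_eq_singleton_of_siteTerm_ne_zero (hamiltonian_apply A ▸ h)⟩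

theorem atMostLocal_hamiltonian : AtMostLocal 2 (hamiltonian h2 h1) := fun A hA => by
  obtain ⟨j, rfl | rfl⟩ := eq_pair_or_eq_singleton_of_hamiltonian_ne_zero hA
  · simp only [setRange_le_iff, Finset.mem_insert, Finset.mem_singleton]
    omega
  · simp [setRange_le_iff]

theorem AtMostLocal.boost (hC : AtMostLocal 1 C) : AtMostLocal 2 (boost h2 h1 C) := fun A hA => by
  by_cases hz : hamiltonian h2 h1 A = 0
  · rw [boost_apply, hz, smul_zero, zero_add] at hA
    exact (hC A hA).trans one_le_two
  · exact atMostLocal_hamiltonian A hz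

theorem sInf_shiftSet {A : Finset ℤ} (hA : A.Nonempty) (x : ℤ) :
    sInf (shiftSet A x : Set ℤ) = sInf (A : Set ℤ) + x := by
  rw [shiftSet, Finset.coe_map]
  exact (Set.Finite.map_sInf_of_monotone (add_left_mono (a := x)) hA A.finite_toSet).symm

theorem isBoost_boost (hinv : IsTranslationInvariant (hamiltonian h2 h1))
    (hCinv : IsTranslationInvariant C) : IsBoost (hamiltonian h2 h1) (boost h2 h1 C) := by
  refine fun x => unshift_eq_iff.2 fun A => ?_
  have hH : (hamiltonian h2 h1 (shiftSet A x) : Op d _) = shiftEquiv A x (hamiltonian h2 h1 A) :=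
    hinv A x
  have hC : (C (shiftSet A x) : Op d _) = shiftEquiv A x (C A) := hCinv A x
  simp only [Pi.add_apply, Pi.smul_apply, boost_apply, Submodule.coe_add, Submodule.coe_smul,
    map_add, map_smul, hH, hC]
  obtain rfl | hA := A.eq_empty_or_nonempty
  · have hempty : hamiltonian h2 h1 ∅ = 0 := by
      by_contra h
      obtain ⟨j, hj | hj⟩ := eq_pair_or_eq_singleton_of_hamiltonian_ne_zero h
      · exact Finset.insert_ne_empty _ _ hj.symm
      · exact Finset.singleton_ne_empty _ hj.symm
    simp [hempty]
  · rw [sInf_shiftSet hA, Int.cast_add, add_smul, add_right_comm]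

end Boost

section Charges

variable {d r s m n : ℕ} [NeZero d] {H B : FormalOp d}

theorem charge_succ (H B : FormalOp d) (hn : 2 ≤ n) :
    charge H B (n + 1) = comm B (charge H B n) := by
  obtain ⟨n, rfl⟩ := Nat.exists_eq_add_of_le' hn
  rfl

theorem AtMostLocal.charge (hH : AtMostLocal r H) (hB : AtMostLocal (s + 1) B) (hn : 2 ≤ n) :
    AtMostLocal (r + (n - 2) * s) (charge H B n) := by
  induction n, hn using Nat.le_induction with
  | base => rwa [Nat.sub_self, zero_mul, add_zero]
  | succ n hn ih =>
    rw [charge_succ H B hn, Nat.sub_add_comm hn, add_one_mul, ← add_assoc, add_comm]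
    exact hB.comm ih

theorem IsLocal.charge (hH : IsLocal H) (hB : IsLocal B) (hn : 2 ≤ n) :
    IsLocal (charge H B n) := by
  induction n, hn using Nat.le_induction with
  | base => exact hH
  | succ n hn ih => exact charge_succ H B hn ▸ hB.comm ih

theorem comm_comm_comm_eq_zero {Q : FormalOp d} (hH : IsLocal H) (hB : IsLocal B)
    (hBH : comm H (comm B H) = 0) (hQ : comm H Q = 0) : comm H (comm H (comm B Q)) = 0 := by
  have hjacobi : comm (comm B H) Q = -comm H (comm B Q) := by
    rw [comm_comm hB hH, hQ, comm_zero, zero_sub]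
  have h : comm H (comm (comm B H) Q) = 0 := by
    have := comm_comm hH (hB.comm hH) Q
    rwa [hBH, zero_comm, hQ, comm_zero, sub_zero, eq_comm] at this
  rwa [hjacobi, comm_neg hH, neg_eq_zero] at h

theorem IsBoost.isTranslationInvariant_charge_and_comm_charge_eq_zero (hboost : IsBoost H B)
    (hH : IsLocal H) (hB : IsLocal B) (hherm : IsHermitian H) (hinv : IsTranslationInvariant H)
    (hcons : comm H (charge H B 3) = 0) (hn : 2 ≤ n) :
    IsTranslationInvariant (charge H B n) ∧ comm H (charge H B n) = 0 := by
  induction n, hn using Nat.le_induction with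
  | base => exact ⟨hinv, comm_self H⟩
  | succ n hn ih =>
    obtain ⟨hQinv, hQ⟩ := ih
    have hlocal := hH.charge hB hn
    rw [charge_succ H B hn]
    have hinv' := hboost.isTranslationInvariant_comm hH hB hQinv hQ
    exact ⟨hinv', comm_eq_zero_of_comm_comm_eq_zero hH hherm hinv (hB.comm hlocal) hinv'
      (comm_comm_comm_eq_zero hH hB hcons hQ)⟩

theorem comm_charge_charge_eq_zero (hH : IsLocal H) (hB : IsLocal B)
    (hcons : ∀ n, 2 ≤ n → comm H (charge H B n) = 0) (hm : 2 ≤ m) (hn : 2 ≤ n) :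
    comm (charge H B m) (charge H B n) = 0 := by
  induction m, hm using Nat.le_induction generalizing n with
  | base => exact hcons n hn
  | succ m hm ih =>
    rw [charge_succ H B hm, comm_comm hB (hH.charge hB hm), ih hn, comm_zero, ← charge_succ H B hn,
      ih (hn.trans n.le_succ), sub_zero]

theorem theorem1_general (hH : AtMostLocal r H) (hherm : IsHermitian H)
    (hinv : IsTranslationInvariant H) (hB : AtMostLocal (s + 1) B) (hboost : IsBoost H B)
    (hcons : comm H (charge H B 3) = 0) :
    (∀ n, 2 ≤ n → AtMostLocal (r + (n - 2) * s) (charge H B n) ∧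
      IsTranslationInvariant (charge H B n) ∧ comm H (charge H B n) = 0) ∧
    (∀ m n, 2 ≤ m → 2 ≤ n → comm (charge H B m) (charge H B n) = 0) := by
  have hQ := fun n (hn : 2 ≤ n) => hboost.isTranslationInvariant_charge_and_comm_charge_eq_zero
    hH.isLocal hB.isLocal hherm hinv hcons hn
  exact ⟨fun n hn => ⟨hH.charge hB hn, hQ n hn⟩, fun m n hm hn =>
    comm_charge_charge_eq_zero hH.isLocal hB.isLocal (fun n hn => (hQ n hn).2) hm hn⟩

end Charges

end SpinChain

open SpinChain in
theorem theorem1 {d : ℕ} [NeZero d]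
    (h2 : (j : ℤ) → tracelessOps d {j, j + 1}) (h1 : (j : ℤ) → tracelessOps d {j})
    (hherm : IsHermitian (hamiltonian h2 h1))
    (hinv : IsTranslationInvariant (hamiltonian h2 h1))
    (C : FormalOp d) (hC : AtMostLocal 1 C) (hCinv : IsTranslationInvariant C)
    (Q : ℕ → FormalOp d) (hQ : Q = charge (hamiltonian h2 h1) (boost h2 h1 C))
    (hcons : comm (hamiltonian h2 h1) (Q 3) = 0) :
    (∀ n, 2 ≤ n → AtMostLocal n (Q n) ∧ IsTranslationInvariant (Q n) ∧
      comm (hamiltonian h2 h1) (Q n) = 0) ∧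
    (∀ m n, 2 ≤ m → 2 ≤ n → comm (Q m) (Q n) = 0) := by
  subst hQ
  obtain ⟨hQ, hcomm⟩ := theorem1_general atMostLocal_hamiltonian hherm hinv hC.boost
    (isBoost_boost hinv hCinv) hcons
  exact ⟨fun n hn => by simpa only [mul_one, Nat.add_sub_cancel' hn] using hQ n hn, hcomm⟩
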